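/- Let $G$ be a (finite-dimensional, real, Hausdorff) Lie group with Lie algebra $\mathcal G$, $\sigma$ a smooth involutive automorphism of $G$ (its derivative on $\mathcal G$ is also denoted $\sigma$), $H$ the subgroup of fixed points of $\sigma$, and $\mathcal G=\mathcal H\oplus\mathcal K$ the decomposition into the eigenspaces of $\sigma$ for $+1$ and $-1$. Let $\mathcal A$ be a maximal commuting subspace of $\mathcal K$, and $\mathcal B\subset\mathcal H$ an abelian subspace such that $\mathcal A\oplus\mathcal B$ is a maximal commutative subalgebra of $\mathcal G$. Assume the root decomposition $$\mathcal G=\mathcal A\oplus\mathcal B\oplus\bigoplus_{\alpha}(\mathbb R\,e_\alpha\oplus\mathbb R\,\sigma e_\alpha),$$ where $(e_\alpha)$ is a finite family of root vectors, $[q,e_\alpha]=\alpha(q)e_\alpha$ for all $q\in\mathcal A$, with $0\neq\alpha\in\mathcal A^*$ (several $e_\alpha$ may belong to the same root), such that the $e_\alpha$ and $\sigma e_\alpha$ are linearly independent. Let $\mu\in\mathcal H^*$, let $H_\mu=\{h\in H:\mathrm{Ad}^*_h\mu=\mu\}$ and $\mathcal H_\mu=\{X\in\mathcal H:\mu([X,Y])=0\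 \forall Y\in\mathcal H\}$ its Lie algebra. Assume $\mathcal H=\mathcal H_\mu\oplus\mathcal B\oplus\mathcal C$, where $\mathcal H_\mu\oplus\mathcal B$ and $\mathcal H_\mu\oplus\mathcal C$ are maximal isotropic subspaces of $\mathcal H$ for $\chi(X,Y)=\mu([X,Y])$. Identify $T^*G$ with $G\times\mathcal G^*$ by left translations and let $$N_\mu=\{(g,\xi)\in G\times\mathcal G^*:\ (\mathrm{Ad}^*_g\xi)|_{\mathcal H}=\mu,\ -\xi|_{\mathcal H}=0\},$$ where $\mathrm{Ad}^*_g\xi(X)=\xi(g^{-1}Xg)$. Write $A=\exp(\mathcal A)$. Let $(Q,L)$ be a point of the section $\mathcal S$, that is $(Q,L)\in N_\mu$ with $Q=\exp(q)$, $q\in\mathcal A$ and $\alpha(q)\neq0$ for all $\alpha$. Let $h_2:G\to G$ be differentiable at $Q$ and such that 1. for $g$ near $Q$: $h_2(g)\in H$ and $g=h_1\,a\,h_2(g)$ for some $h_1\in H$, $a\in A$; 2. $h_2(kah)=h$ for all $(k,a,h)\in H_\mu\times A\times H$ near $(1,Q,1)$ such that $(kah,\xi)\in N_\mu$ for some $\xi$;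 3. $\nabla_g h_2(Q^{-1}XQ)=0$ for all $X\in\mathcal C$, where $\nabla_g h_2(X)=\frac{d}{dt}h_2(Q\exp(tX))|_{t=0}$. (By 2, $h_2(Q)=1$, so $\nabla_gh_2$ takes its values in $\mathcal G$.) Then the elements of $\mathcal K$ are exactly those $X\in\mathcal G$ that can be written uniquely as $X=X_0+\sum_\alpha X_\alpha(e_\alpha-\sigma e_\alpha)$ with $X_0\in\mathcal A$, $X_\alpha\in\mathbb R$; and there is a linear map $h_0:\mathcal G\to\mathcal B$ such that for every such $X\in\mathcal K$ $$\nabla_g h_2(X)=-h_0(X)+\sum_\alpha X_\alpha\coth(\alpha(q))\,(e_\alpha+\sigma e_\alpha),$$ and $h_0(X)$ is the unique element $b$ of $\mathcal B$ for which $$b-\sum_\alpha\frac{X_\alpha}{\sinh\alpha(q)}\,(e_\alpha+\sigma e_\alpha)\in\mathcal H_\mu\oplus\mathcal C .$$ -/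

import Mathlib

open scoped Manifold ContDiff Topology

namespace SymmetricReduction

noncomputable section

/-- A smooth real Lie group has the regularity needed for its Lie algebra. -/
instance lieGroupMinSmoothness {E : Type*} [NormedAddCommGroup E] [NormedSpace ℝ E]
    {G : Type*} [TopologicalSpace G] [ChartedSpace E G] [Group G] [LieGroup 𝓘(ℝ, E) ∞ G] :
    LieGroup 𝓘(ℝ, E) (minSmoothness ℝ 3) G :=
  LieGroup.of_le (n := ∞) (by
    rw [minSmoothness_of_isRCLikeNormedField]
    exact WithTop.coe_le_coe.2 (le_top : (3 : ℕ∞) ≤ ⊤))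

variable {E : Type*} [NormedAddCommGroup E] [NormedSpace ℝ E]
  {G : Type*} [TopologicalSpace G] [ChartedSpace E G] [Group G]

/-- The adjoint action `X ↦ g X g⁻¹` of `g` on the Lie algebra: the derivative at `1` of
conjugation by `g`. -/
def Ad (g : G) : GroupLieAlgebra 𝓘(ℝ, E) G →L[ℝ] GroupLieAlgebra 𝓘(ℝ, E) G :=
  mfderiv 𝓘(ℝ, E) 𝓘(ℝ, E) (fun x : G => g * x * g⁻¹) 1

/-- The derivative at `1` of a group endomorphism, as an endomorphism of the Lie algebra. -/
def dOne (σ : G →* G) : GroupLieAlgebra 𝓘(ℝ, E) G →L[ℝ] GroupLieAlgebra 𝓘(ℝ, E) G :=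
  mfderiv 𝓘(ℝ, E) 𝓘(ℝ, E) (fun x : G => σ x) 1

/-- `∇_g f (X)`, the derivative of `t ↦ f (g exp (tX))` at `t = 0`, for a map `f : G → G`,
computed as the derivative of `x ↦ f (g x)` at `1` in the direction `X`.
When `f g = 1`, as for the function `h₂` at the points of the section,
it is an element of the Lie algebra. -/
def nabla (f : G → G) (g : G) : GroupLieAlgebra 𝓘(ℝ, E) G →L[ℝ] GroupLieAlgebra 𝓘(ℝ, E) G :=
  mfderiv 𝓘(ℝ, E) 𝓘(ℝ, E) (fun x : G => f (g * x)) 1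

/-- `γ` is the one-parameter subgroup of `G` with velocity `X`, that is `γ t = exp (tX)`. -/
structure IsOneParameterSubgroup (X : GroupLieAlgebra 𝓘(ℝ, E) G) (γ : ℝ → G) : Prop where
  map_zero : γ 0 = 1
  map_add : ∀ s t : ℝ, γ (s + t) = γ s * γ t
  velocity : HasMFDerivAt 𝓘(ℝ, ℝ) 𝓘(ℝ, E) γ 0 (ContinuousLinearMap.toSpanSingleton ℝ (X : E))

/-- `g = exp X`. -/
def IsExp (X : GroupLieAlgebra 𝓘(ℝ, E) G) (g : G) : Prop :=
  ∃ γ : ℝ → G, IsOneParameterSubgroup X γ ∧ γ 1 = g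

/-- The subset `exp 𝔞` of `G`. -/
def expSet (𝔞 : Submodule ℝ (GroupLieAlgebra 𝓘(ℝ, E) G)) : Set G :=
  {g | ∃ X ∈ 𝔞, IsExp X g}

/-- `σ` is a smooth involutive automorphism of `G`. -/
structure IsInvolution (E : Type*) [NormedAddCommGroup E] [NormedSpace ℝ E]
    {G : Type*} [TopologicalSpace G] [ChartedSpace E G] [Group G] (σ : G →* G) : Prop where
  smooth : ContMDiff 𝓘(ℝ, E) 𝓘(ℝ, E) ∞ (fun x : G => σ x)
  involutive : ∀ x : G, σ (σ x) = x

/-- The subgroup `H` of fixed points of `σ`. -/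
def fixedSubgroup (σ : G →* G) : Subgroup G :=
  σ.eqLocus (MonoidHom.id G)

/-- The eigenspace `𝓗` of `σ` (acting on the Lie algebra) for the eigenvalue `1`. -/
def hAlg (E : Type*) [NormedAddCommGroup E] [NormedSpace ℝ E]
    {G : Type*} [TopologicalSpace G] [ChartedSpace E G] [Group G] (σ : G →* G) :
    Submodule ℝ (GroupLieAlgebra 𝓘(ℝ, E) G) where
  carrier := {X | dOne σ X = X}
  add_mem' := by
    intro X Y hX hY
    have hX' : dOne σ X = X := hX
    have hY' : dOne σ Y = Y := hY
    change dOne σ (X + Y) = X + Y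
    rw [ContinuousLinearMap.map_add, hX', hY']
  zero_mem' := (dOne σ).map_zero
  smul_mem' := by
    intro c X hX
    have hX' : dOne σ X = X := hX
    change dOne σ (c • X) = c • X
    rw [ContinuousLinearMap.map_smul, hX']

/-- The eigenspace `𝓚` of `σ` (acting on the Lie algebra) for the eigenvalue `-1`. -/
def kAlg (E : Type*) [NormedAddCommGroup E] [NormedSpace ℝ E]
    {G : Type*} [TopologicalSpace G] [ChartedSpace E G] [Group G] (σ : G →* G) :
    Submodule ℝ (GroupLieAlgebra 𝓘(ℝ, E) G) where
  carrier := {X | dOne σ X = -X}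
  add_mem' := by
    intro X Y hX hY
    have hX' : dOne σ X = -X := hX
    have hY' : dOne σ Y = -Y := hY
    change dOne σ (X + Y) = -(X + Y)
    rw [ContinuousLinearMap.map_add, hX', hY', neg_add]
  zero_mem' := by
    change dOne σ 0 = -0
    rw [ContinuousLinearMap.map_zero, neg_zero]
  smul_mem' := by
    intro c X hX
    have hX' : dOne σ X = -X := hX
    change dOne σ (c • X) = -(c • X)
    rw [ContinuousLinearMap.map_smul, hX', smul_neg]

/-- `T = U ⊕ V ⊕ W`, an internal direct sum of subspaces. -/
structure IsDirectSum {𝔤 : Type*} [AddCommGroup 𝔤] [Module ℝ 𝔤]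
    (T U V W : Submodule ℝ 𝔤) : Prop where
  sup_eq : U ⊔ V ⊔ W = T
  disjoint_left : Disjoint U V
  disjoint_right : Disjoint (U ⊔ V) W

/-- `𝓐` is a maximal commuting subspace of `𝓚`, and `𝓑` is an abelian subspace of `𝓗` such that
`𝓐 ⊕ 𝓑` is a maximal commutative subalgebra of the Lie algebra. -/
structure IsCartanPair (σ : G →* G) (𝓐 𝓑 : Submodule ℝ (GroupLieAlgebra 𝓘(ℝ, E) G)) :
    Prop where
  le_kAlg : 𝓐 ≤ kAlg E σ
  commute : ∀ X ∈ 𝓐, ∀ Y ∈ 𝓐, ⁅X, Y⁆ = 0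
  maximal : ∀ X ∈ kAlg E σ, (∀ Y ∈ 𝓐, ⁅X, Y⁆ = 0) → X ∈ 𝓐
  le_hAlg : 𝓑 ≤ hAlg E σ
  commute_sup : ∀ X ∈ 𝓐 ⊔ 𝓑, ∀ Y ∈ 𝓐 ⊔ 𝓑, ⁅X, Y⁆ = 0
  maximal_sup : ∀ X : GroupLieAlgebra 𝓘(ℝ, E) G, (∀ Y ∈ 𝓐 ⊔ 𝓑, ⁅X, Y⁆ = 0) → X ∈ 𝓐 ⊔ 𝓑

/-- The root decomposition under `𝓐`: the `e i`, `i : ι`, are root vectors for the (nonzero)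
roots `α i`, the vectors `e i` and `σ (e i)` are linearly independent, and the Lie algebra is the
direct sum of `𝓐`, `𝓑` and the span of the `e i` and the `σ (e i)`. The family `α` is the half
`Φ'` of the set of roots, with multiplicities, and `σ (e i)` is a root vector for the root
`σ (α i) = -α i`. -/
structure IsRootDecomposition {ι : Type*} (σ : G →* G)
    (𝓐 𝓑 : Submodule ℝ (GroupLieAlgebra 𝓘(ℝ, E) G))
    (e : ι → GroupLieAlgebra 𝓘(ℝ, E) G) (α : ι → Module.Dual ℝ 𝓐) : Prop where
  root_ne_zero : ∀ i, α i ≠ 0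
  root_vector : ∀ (i : ι) (q : 𝓐), ⁅(q : GroupLieAlgebra 𝓘(ℝ, E) G), e i⁆ = α i q • e i
  linearIndependent : LinearIndependent ℝ (Sum.elim e (fun i => dOne σ (e i)))
  decomposition : IsDirectSum ⊤ 𝓐 𝓑
    (Submodule.span ℝ (Set.range (Sum.elim e (fun i => dOne σ (e i)))))

/-- The isotropy group `H_μ` of `μ` in `H` for the coadjoint action. The momentum `μ ∈ 𝓗*` is
given as the restriction to `𝓗` of a linear form on the Lie algebra. -/
def isotropyGroup (σ : G →* G) (μ : Module.Dual ℝ (GroupLieAlgebra 𝓘(ℝ, E) G)) : Set G :=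
  {h | h ∈ fixedSubgroup σ ∧ ∀ X ∈ hAlg E σ, μ (Ad h⁻¹ X) = μ X}

/-- The Lie algebra `𝓗_μ` of `H_μ`. -/
def isotropyAlgebra [LieGroup 𝓘(ℝ, E) ∞ G] [CompleteSpace E] (σ : G →* G)
    (μ : Module.Dual ℝ (GroupLieAlgebra 𝓘(ℝ, E) G)) :
    Submodule ℝ (GroupLieAlgebra 𝓘(ℝ, E) G) where
  carrier := {X | X ∈ hAlg E σ ∧ ∀ Y ∈ hAlg E σ, μ ⁅X, Y⁆ = 0}
  add_mem' := by
    rintro X X' ⟨hX, hX0⟩ ⟨hX', hX0'⟩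
    refine ⟨(hAlg E σ).add_mem hX hX', fun Y hY => ?_⟩
    rw [add_lie, LinearMap.map_add, hX0 Y hY, hX0' Y hY, add_zero]
  zero_mem' := ⟨(hAlg E σ).zero_mem, fun Y _ => by rw [zero_lie, LinearMap.map_zero]⟩
  smul_mem' := by
    rintro c X ⟨hX, hX0⟩
    refine ⟨(hAlg E σ).smul_mem c hX, fun Y hY => ?_⟩
    rw [smul_lie, LinearMap.map_smul, hX0 Y hY, smul_zero]

/-- `W` is a maximal isotropic subspace of `𝓗` for the form `χ (X, Y) = μ [X, Y]`. -/
def IsMaximalIsotropic (σ : G →* G) (μ : Module.Dual ℝ (GroupLieAlgebra 𝓘(ℝ, E) G))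
    (W : Submodule ℝ (GroupLieAlgebra 𝓘(ℝ, E) G)) : Prop :=
  Maximal (fun V : Submodule ℝ (GroupLieAlgebra 𝓘(ℝ, E) G) =>
    V ≤ hAlg E σ ∧ ∀ X ∈ V, ∀ Y ∈ V, μ ⁅X, Y⁆ = 0) W

/-- `𝓗 = 𝓗_μ ⊕ 𝓑 ⊕ 𝓒`, where `𝓑` and `𝓒` are maximal isotropic modulo `𝓗_μ`, the kernel of the
form `χ` on `𝓗`. -/
structure IsMomentumSplitting [LieGroup 𝓘(ℝ, E) ∞ G] [CompleteSpace E] (σ : G →* G)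
    (μ : Module.Dual ℝ (GroupLieAlgebra 𝓘(ℝ, E) G))
    (𝓑 𝓒 : Submodule ℝ (GroupLieAlgebra 𝓘(ℝ, E) G)) : Prop where
  directSum : IsDirectSum (hAlg E σ) (isotropyAlgebra σ μ) 𝓑 𝓒
  isotropic_left : IsMaximalIsotropic σ μ (isotropyAlgebra σ μ ⊔ 𝓑)
  isotropic_right : IsMaximalIsotropic σ μ (isotropyAlgebra σ μ ⊔ 𝓒)

/-- The submanifold `N_μ` of `T*G = G × 𝓖*` (left trivialisation), on which the moments of the left
and right actions of `H`, the restrictions to `𝓗` of `Ad*_g ξ` and of `-ξ`, are `μ` and `0`. -/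
def levelSet (σ : G →* G) (μ : Module.Dual ℝ (GroupLieAlgebra 𝓘(ℝ, E) G)) :
    Set (G × Module.Dual ℝ (GroupLieAlgebra 𝓘(ℝ, E) G)) :=
  {p | (∀ X ∈ hAlg E σ, p.2 (Ad p.1⁻¹ X) = μ X) ∧ ∀ X ∈ hAlg E σ, -p.2 X = 0}

/-- `h₂` is, near the point `Q` of `A = exp 𝓐`, the right factor of a decomposition
`g = h₁ a h₂` with `h₁, h₂ ∈ H` and `a ∈ A`. It is a function of `g` only, which on `N_μ` is the
right factor of the decomposition with `h₁ ∈ H_μ`, and which satisfies the normalisation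
`D_Q = 0` on `𝓒`, where `D_Q X = ∇_g h₂ (Q⁻¹ X Q)`. -/
structure IsRightFactor (σ : G →* G) (𝓐 𝓒 : Submodule ℝ (GroupLieAlgebra 𝓘(ℝ, E) G))
    (μ : Module.Dual ℝ (GroupLieAlgebra 𝓘(ℝ, E) G)) (Q : G) (h₂ : G → G) : Prop where
  mdifferentiableAt : MDifferentiableAt 𝓘(ℝ, E) 𝓘(ℝ, E) h₂ Q
  decomposition : ∀ᶠ g in 𝓝 Q, h₂ g ∈ fixedSubgroup σ ∧
    ∃ h₁ ∈ fixedSubgroup σ, ∃ a ∈ expSet 𝓐, g = h₁ * a * h₂ g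
  on_levelSet : ∀ᶠ p : G × G × G in 𝓝 (1, Q, 1),
    p.1 ∈ isotropyGroup σ μ → p.2.1 ∈ expSet 𝓐 → p.2.2 ∈ fixedSubgroup σ →
    (∃ ξ, (p.1 * p.2.1 * p.2.2, ξ) ∈ levelSet σ μ) → h₂ (p.1 * p.2.1 * p.2.2) = p.2.2
  normalisation : ∀ X ∈ 𝓒, nabla h₂ Q (Ad Q⁻¹ X) = 0

end

end SymmetricReduction

/-! Put `D X = ∇h₂(Q⁻¹XQ)`. The formula follows once `∇h₂` is known on `𝓗` and on `𝓐` and `D` is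
known on `𝓗`.

On `𝓗`, `∇h₂` is the identity: translating `(Q, L)` on the right by `exp(tX) ∈ H` stays in `N_μ`,
and condition 2 gives `h₂(Q exp(tX)) = exp(tX)`. On `𝓗_μ`, `D` vanishes, by the same argument with
translations on the left by `H_μ`; on `𝓒` it vanishes by the normalisation. On `𝓑`, `D` is the
identity, because `𝓑` commutes with `q` and so `Q⁻¹bQ = b ∈ 𝓗`. Hence `D` restricted to `𝓗 = 𝓗_μ ⊕ 𝓑
⊕ 𝓒` is the projection `P` onto `𝓑`.

On `𝓐`, `∇h₂` vanishes: `Q exp(tY)` remains in `A` and remains regular for small `t`, and `N_μ` has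
a point over each such element (`exists_mem_levelSet`), so condition 2 gives `h₂(Q exp(tY)) = 1`.

Since `e` and `σe` have eigenvalues `α(q)` and `-α(q)` under `ad q`, `Ad Q⁻¹ (e + σe) = cosh α(q) (e
+ σe) - sinh α(q) (e - σe)`. Solving for `e - σe` and applying `∇h₂` gives `coth α(q) (e + σe) - P(e
+ σe) / sinh α(q)`; summation yields the theorem, with `h₀` the projection of `∑ X_α (e + σe) / sinh
α(q)`.

The analytic input is that `d/dt Ad(exp tX) Y = [X, Y]` at `t = 0` for the bracket of left invariant
fields (`hasDerivAt_Ad_of_hasMFDerivAt`), with existence and uniqueness of one-parameter subgroups.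
-/

namespace SymmetricReduction

/-! ### Group operations read in the chart at the identity. -/

section ChartAtOne

variable {E : Type*} [NormedAddCommGroup E] [NormedSpace ℝ E]
  {G : Type*} [TopologicalSpace G] [ChartedSpace E G] [Group G]

/-- A map of two variables in `G`, written in the preferred chart at `1`. -/
noncomputable def inChart (f : G × G → G) (z : E × E) : E :=
  extChartAt 𝓘(ℝ, E) (1 : G)
    (f ((extChartAt 𝓘(ℝ, E) (1 : G)).symm z.1, (extChartAt 𝓘(ℝ, E) (1 : G)).symm z.2))

/-- The image of `1` in the preferred chart at `1`. -/
noncomputable def chartOne (E : Type*) [NormedAddCommGroup E] [NormedSpace ℝ E]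
    (G : Type*) [TopologicalSpace G] [ChartedSpace E G] [Group G] : E :=
  extChartAt 𝓘(ℝ, E) (1 : G) 1

lemma symm_chartOne : (extChartAt 𝓘(ℝ, E) (1 : G)).symm (chartOne E G) = 1 :=
  extChartAt_to_inv (I := 𝓘(ℝ, E)) (1 : G)

lemma target_mem_nhds_chartOne :
    (extChartAt 𝓘(ℝ, E) (1 : G)).target ∈ 𝓝 (chartOne E G) :=
  extChartAt_target_mem_nhds (I := 𝓘(ℝ, E)) (1 : G)

lemma source_mem_nhds_one :
    (extChartAt 𝓘(ℝ, E) (1 : G)).source ∈ 𝓝 (1 : G) :=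
  extChartAt_source_mem_nhds (I := 𝓘(ℝ, E)) (1 : G)

lemma continuousAt_symm_chartOne :
    ContinuousAt (extChartAt 𝓘(ℝ, E) (1 : G)).symm (chartOne E G) :=
  continuousAt_extChartAt_symm (I := 𝓘(ℝ, E)) (1 : G)

lemma tendsto_symm_chartOne :
    Filter.Tendsto (extChartAt 𝓘(ℝ, E) (1 : G)).symm (𝓝 (chartOne E G)) (𝓝 1) := by
  have h := continuousAt_symm_chartOne (E := E) (G := G)
  rwa [ContinuousAt, symm_chartOne] at h

section

variable [LieGroup 𝓘(ℝ, E) ∞ G]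

lemma contMDiffAt_symm_chartOne :
    ContMDiffAt 𝓘(ℝ, E) 𝓘(ℝ, E) ∞ (extChartAt 𝓘(ℝ, E) (1 : G)).symm (chartOne E G) := by
  have : IsManifold 𝓘(ℝ, E) ∞ G := LieGroup.toContMDiffMul.toIsManifold
  exact (contMDiffOn_extChartAt_symm (I := 𝓘(ℝ, E)) (n := ∞) (1 : G)).contMDiffAt
    target_mem_nhds_chartOne

lemma contDiffAt_inChart {f : G × G → G}
    (hf : ContMDiff (𝓘(ℝ, E).prod 𝓘(ℝ, E)) 𝓘(ℝ, E) ∞ f) (h1 : f (1, 1) = 1) :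
    ContDiffAt ℝ ∞ (inChart f) (chartOne E G, chartOne E G) := by
  have : IsManifold 𝓘(ℝ, E) ∞ G := LieGroup.toContMDiffMul.toIsManifold
  rw [← contMDiffAt_iff_contDiffAt]
  have hs := contMDiffAt_symm_chartOne (E := E) (G := G)
  have a : ContMDiffAt 𝓘(ℝ, E × E) (𝓘(ℝ, E).prod 𝓘(ℝ, E)) ∞
      (fun z : E × E => ((extChartAt 𝓘(ℝ, E) (1 : G)).symm z.1,
        (extChartAt 𝓘(ℝ, E) (1 : G)).symm z.2)) (chartOne E G, chartOne E G) := by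
    refine ContMDiffAt.prodMk ?_ ?_
    · exact ContMDiffAt.comp (chartOne E G, chartOne E G) (g := (extChartAt 𝓘(ℝ, E) (1 : G)).symm)
        (I' := 𝓘(ℝ, E)) hs contDiffAt_fst.contMDiffAt
    · exact ContMDiffAt.comp (chartOne E G, chartOne E G) (g := (extChartAt 𝓘(ℝ, E) (1 : G)).symm)
        (I' := 𝓘(ℝ, E)) hs contDiffAt_snd.contMDiffAt
  have c : ContMDiffAt 𝓘(ℝ, E) 𝓘(ℝ, E) ∞ (extChartAt 𝓘(ℝ, E) (1 : G))
      (f ((extChartAt 𝓘(ℝ, E) (1 : G)).symm (chartOne E G),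
        (extChartAt 𝓘(ℝ, E) (1 : G)).symm (chartOne E G))) := by
    rw [symm_chartOne, h1]
    exact contMDiffAt_extChartAt
  exact ContMDiffAt.comp (chartOne E G, chartOne E G)
    (g := fun w : G × G => extChartAt 𝓘(ℝ, E) (1 : G) (f w)) (I' := 𝓘(ℝ, E).prod 𝓘(ℝ, E))
    (ContMDiffAt.comp _ (g := extChartAt 𝓘(ℝ, E) (1 : G)) (I' := 𝓘(ℝ, E)) c (hf _)) a

end

/-- The derivative at `1` of a map fixing `1` is the derivative of its expression in the chart. -/
lemma hasFDerivAt_chart_of_hasMFDerivAt {f : G → G} (h1 : f 1 = 1) {D : E →L[ℝ] E}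
    (hf : HasMFDerivAt 𝓘(ℝ, E) 𝓘(ℝ, E) f 1 D) :
    HasFDerivAt (fun x => extChartAt 𝓘(ℝ, E) (1 : G) (f ((extChartAt 𝓘(ℝ, E) (1 : G)).symm x))) D
      (chartOne E G) := by
  have h : HasFDerivWithinAt (writtenInExtChartAt 𝓘(ℝ, E) 𝓘(ℝ, E) 1 f : E → E) D
    (Set.range 𝓘(ℝ, E)) (chartOne E G) := hf.2
  rw [writtenInExtChartAt, h1] at h
  rw [modelWithCornersSelf_coe, Set.range_id, hasFDerivWithinAt_univ] at h
  exact h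

lemma hasFDerivAt_chart_of_hasMFDerivAt_vector {f : G → E} {D : E →L[ℝ] E}
    (hf : HasMFDerivAt 𝓘(ℝ, E) 𝓘(ℝ, E) f 1 D) :
    HasFDerivAt (fun x => f ((extChartAt 𝓘(ℝ, E) (1 : G)).symm x)) D (chartOne E G) := by
  have h : HasFDerivWithinAt (writtenInExtChartAt 𝓘(ℝ, E) 𝓘(ℝ, E) 1 f : E → E) D
    (Set.range 𝓘(ℝ, E)) (chartOne E G) := hf.2
  rw [modelWithCornersSelf_coe, Set.range_id, hasFDerivWithinAt_univ] at h
  exact h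

/-- The derivative of a partial map, in terms of that of `inChart`. -/
lemma hasFDerivAt_inChart_snd {f : G × G → G} {x : E}
    (hf : DifferentiableAt ℝ (inChart f) (x, chartOne E G)) :
    HasFDerivAt (fun y => inChart f (x, y))
      ((fderiv ℝ (inChart f) (x, chartOne E G)).comp (ContinuousLinearMap.inr ℝ E E))
      (chartOne E G) :=
  hf.hasFDerivAt.comp _ (hasFDerivAt_prodMk_right x (chartOne E G))

end ChartAtOne

/-! ### The adjoint action and left invariant fields as partial derivatives in the chart. -/

section AdjointDerivative

variable {E : Type*} [NormedAddCommGroup E] [NormedSpace ℝ E]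
  {G : Type*} [TopologicalSpace G] [ChartedSpace E G] [Group G] [LieGroup 𝓘(ℝ, E) ∞ G]

/-- Multiplication in the chart. -/
noncomputable def chartMul (E : Type*) [NormedAddCommGroup E] [NormedSpace ℝ E]
    (G : Type*) [TopologicalSpace G] [ChartedSpace E G] [Group G] : E × E → E :=
  inChart (fun z : G × G => z.1 * z.2)

/-- Conjugation in the chart. -/
noncomputable def chartConj (E : Type*) [NormedAddCommGroup E] [NormedSpace ℝ E]
    (G : Type*) [TopologicalSpace G] [ChartedSpace E G] [Group G] : E × E → E :=
  inChart (fun z : G × G => z.1 * z.2 * z.1⁻¹)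

lemma contMDiff_conj (g : G) :
    ContMDiff 𝓘(ℝ, E) 𝓘(ℝ, E) ∞ (fun x : G => g * x * g⁻¹) :=
  (contMDiff_mul_right (I := 𝓘(ℝ, E)) (n := ∞) (a := g⁻¹)).comp
    (contMDiff_mul_left (I := 𝓘(ℝ, E)) (n := ∞) (a := g))

lemma contDiffAt_chartMul :
    ContDiffAt ℝ ∞ (chartMul E G) (chartOne E G, chartOne E G) :=
  contDiffAt_inChart (contMDiff_mul 𝓘(ℝ, E) ∞) (mul_one 1)

lemma contDiffAt_chartConj :
    ContDiffAt ℝ ∞ (chartConj E G) (chartOne E G, chartOne E G) := by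
  have : LieGroup 𝓘(ℝ, E) ∞ G := inferInstance
  refine contDiffAt_inChart ?_ (by simp)
  exact (contMDiff_fst.mul contMDiff_snd).mul contMDiff_fst.inv

lemma eventually_differentiableAt {f : E × E → E} {p : E × E} (hf : ContDiffAt ℝ ∞ f p) :
    ∀ᶠ z in 𝓝 p, DifferentiableAt ℝ f z := by
  have h1 : ContDiffAt ℝ 1 f p := hf.of_le (by exact_mod_cast le_top)
  filter_upwards [h1.eventually (by simp)] with z hz using hz.differentiableAt (by simp)

lemma eventually_differentiableAt_left {f : E × E → E} {p : E} (hf : ContDiffAt ℝ ∞ f (p, p)) :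
    ∀ᶠ x in 𝓝 p, DifferentiableAt ℝ f (x, p) :=
  ((continuous_id.prodMk continuous_const : Continuous fun x : E => (x, p)).tendsto p).eventually
    (eventually_differentiableAt hf)

lemma mdifferentiableAt_conj (g : G) (h : G) :
    MDifferentiableAt 𝓘(ℝ, E) 𝓘(ℝ, E) (fun x : G => g * x * g⁻¹) h :=
  (contMDiff_conj g).mdifferentiableAt (by simp)

lemma hasMFDerivAt_Ad (g : G) :
    HasMFDerivAt 𝓘(ℝ, E) 𝓘(ℝ, E) (fun x : G => g * x * g⁻¹) 1
      (Ad g : GroupLieAlgebra 𝓘(ℝ, E) G →L[ℝ] GroupLieAlgebra 𝓘(ℝ, E) G) :=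
  (mdifferentiableAt_conj g 1).hasMFDerivAt

lemma eventually_Ad_eq_fderiv_chartConj (Y : GroupLieAlgebra 𝓘(ℝ, E) G) :
    ∀ᶠ x in 𝓝 (chartOne E G),
      (Ad ((extChartAt 𝓘(ℝ, E) (1 : G)).symm x) Y : E) =
        fderiv ℝ (chartConj E G) (x, chartOne E G) ((0 : E), (Y : E)) := by
  filter_upwards [eventually_differentiableAt_left (contDiffAt_chartConj (E := E) (G := G))]
    with x hx
  have h1 := hasFDerivAt_chart_of_hasMFDerivAt (by simp)
    (hasMFDerivAt_Ad (E := E) ((extChartAt 𝓘(ℝ, E) (1 : G)).symm x))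
  have h2 := hasFDerivAt_inChart_snd hx
  have := h1.unique h2
  exact DFunLike.congr_fun this (Y : E)

/-- The left invariant vector field with value `Y` at `1`, in the chart at `1`. -/
lemma eventually_mpullbackWithin_mulInvariantVectorField (Y : GroupLieAlgebra 𝓘(ℝ, E) G) :
    ∀ᶠ x in 𝓝 (chartOne E G),
      (VectorField.mpullbackWithin 𝓘(ℝ, E) 𝓘(ℝ, E) (extChartAt 𝓘(ℝ, E) (1 : G)).symm
        (mulInvariantVectorField Y) (Set.range 𝓘(ℝ, E)) x : E) =
        fderiv ℝ (chartMul E G) (x, chartOne E G) ((0 : E), (Y : E)) := by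
  have : IsManifold 𝓘(ℝ, E) ∞ G := LieGroup.toContMDiffMul.toIsManifold
  have : IsManifold 𝓘(ℝ, E) 1 G := IsManifold.of_le (n := ∞) (by exact_mod_cast le_top)
  filter_upwards [eventually_differentiableAt_left (contDiffAt_chartMul (E := E) (G := G)),
    target_mem_nhds_chartOne] with x hx hxt
  -- Pulling back by the inverse chart is pushing forward by the chart, so the field becomes the
  -- derivative at `1` of `y ↦ chart (g * y)`.
  have hinv : (mfderivWithin 𝓘(ℝ, E) 𝓘(ℝ, E) (extChartAt 𝓘(ℝ, E) (1 : G)).symm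
      (Set.range 𝓘(ℝ, E)) x).inverse = mfderiv 𝓘(ℝ, E) 𝓘(ℝ, E) (extChartAt 𝓘(ℝ, E) (1 : G))
        ((extChartAt 𝓘(ℝ, E) (1 : G)).symm x) :=
    ContinuousLinearMap.inverse_eq
      (mfderivWithin_extChartAt_symm_comp_mfderiv_extChartAt hxt)
      (mfderiv_extChartAt_comp_mfderivWithin_extChartAt_symm hxt)
  rw [VectorField.mpullbackWithin_apply, hinv]
  set g := (extChartAt 𝓘(ℝ, E) (1 : G)).symm x with hg
  have hgs : g ∈ (chartAt E (1 : G)).source := by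
    rw [← extChartAt_source 𝓘(ℝ, E)]
    exact (extChartAt 𝓘(ℝ, E) (1 : G)).map_target hxt
  have h1 : HasMFDerivAt 𝓘(ℝ, E) 𝓘(ℝ, E) (extChartAt 𝓘(ℝ, E) (1 : G)) (g * 1)
      (mfderiv 𝓘(ℝ, E) 𝓘(ℝ, E) (extChartAt 𝓘(ℝ, E) (1 : G)) g : E →L[ℝ] E) := by
    rw [mul_one]
    exact (mdifferentiableAt_extChartAt hgs).hasMFDerivAt
  have h2 : HasMFDerivAt 𝓘(ℝ, E) 𝓘(ℝ, E) (fun y : G => g * y) 1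
      (mfderiv 𝓘(ℝ, E) 𝓘(ℝ, E) (fun y : G => g * y) 1) :=
    ((contMDiff_mul_left (I := 𝓘(ℝ, E)) (n := ∞) (a := g)).mdifferentiableAt
      (by simp)).hasMFDerivAt
  have h3 := hasFDerivAt_chart_of_hasMFDerivAt_vector (h1.comp (1 : G) h2)
  have := h3.unique (hasFDerivAt_inChart_snd hx)
  exact DFunLike.congr_fun this (Y : E)

end AdjointDerivative

/-! ### Second derivatives of multiplication and conjugation. -/

section ChartCalculus

variable {E : Type*} [NormedAddCommGroup E] [NormedSpace ℝ E]

lemma differentiableAt_fderiv_of_contDiffAt {f : E × E → E} {p : E × E}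
    (hf : ContDiffAt ℝ ∞ f p) : DifferentiableAt ℝ (fderiv ℝ f) p := by
  have h2 : ContDiffAt ℝ 2 f p := hf.of_le (WithTop.coe_le_coe.2 (le_top : (2 : ℕ∞) ≤ ⊤))
  have h : ContDiffAt ℝ 1 (fderiv ℝ f) p := h2.fderiv_right (by norm_num)
  exact h.differentiableAt (by simp)

lemma hasFDerivAt_fderiv_left {f : E × E → E} {p : E} (hf : ContDiffAt ℝ ∞ f (p, p)) (Y : E) :
    HasFDerivAt (fun x => fderiv ℝ f (x, p) ((0 : E), Y))
      (((fderiv ℝ (fderiv ℝ f) (p, p)).comp (ContinuousLinearMap.inl ℝ E E)).flip ((0 : E), Y))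
      p := by
  have h := HasFDerivAt.comp (f := fun x : E => (x, p)) p
    (differentiableAt_fderiv_of_contDiffAt hf).hasFDerivAt (hasFDerivAt_prodMk_left (𝕜 := ℝ) p p)
  exact (h.clm_apply (hasFDerivAt_const ((0 : E), Y) p)).congr_fderiv (by ext; simp)

/-- The product rule: both the base point and the vector to which the derivative is applied depend
on `x`. -/
lemma hasFDerivAt_fderiv_right {f : E × E → E} {p : E} (hf : ContDiffAt ℝ ∞ f (p, p))
    {A : E → E} (hA : DifferentiableAt ℝ A p) :
    HasFDerivAt (fun x => fderiv ℝ f (p, x) (A x, (0 : E)))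
      ((fderiv ℝ f (p, p)).comp ((fderiv ℝ A p).prod 0) +
        ((fderiv ℝ (fderiv ℝ f) (p, p)).comp (ContinuousLinearMap.inr ℝ E E)).flip (A p, (0 : E)))
      p := by
  have h := HasFDerivAt.comp (f := fun x : E => (p, x)) p
    (differentiableAt_fderiv_of_contDiffAt hf).hasFDerivAt (hasFDerivAt_prodMk_right (𝕜 := ℝ) p p)
  exact h.clm_apply (hA.hasFDerivAt.prodMk (hasFDerivAt_const (0 : E) p))

/-- The relation `m (c (x, y), x) = m (x, y)`, differentiated in `y`. -/
lemma eventually_fderiv_mul_conj {m c : E × E → E} {p : E} (hm : ContDiffAt ℝ ∞ m (p, p))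
    (hc : ContDiffAt ℝ ∞ c (p, p)) (hcp : ∀ x, c (x, p) = p)
    (hmc : ∀ᶠ z in 𝓝 (p, p), m (c z, z.1) = m z) (Y : E) :
    ∀ᶠ x in 𝓝 p, fderiv ℝ m (p, x) (fderiv ℝ c (x, p) ((0 : E), Y), (0 : E)) =
      fderiv ℝ m (x, p) ((0 : E), Y) := by
  have hleft : Filter.Tendsto (fun x : E => (x, p)) (𝓝 p) (𝓝 (p, p)) :=
    (continuous_id.prodMk continuous_const).tendsto p
  have hright : Filter.Tendsto (fun x : E => (p, x)) (𝓝 p) (𝓝 (p, p)) :=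
    (continuous_const.prodMk continuous_id).tendsto p
  filter_upwards [hleft.eventually hmc.eventually_nhds,
    hleft.eventually (eventually_differentiableAt hm),
    hright.eventually (eventually_differentiableAt hm),
    hleft.eventually (eventually_differentiableAt hc)] with x h1 h2 h3 h4
  have e1 : HasFDerivAt (fun y => c (x, y)) _ p :=
    h4.hasFDerivAt.comp p (hasFDerivAt_prodMk_right (𝕜 := ℝ) x p)
  have e2 : HasFDerivAt (fun y => m (x, y)) _ p :=
    h2.hasFDerivAt.comp p (hasFDerivAt_prodMk_right (𝕜 := ℝ) x p)
  have e4 : HasFDerivAt m (fderiv ℝ m (p, x)) (c (x, p), x) := by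
    rw [hcp]; exact h3.hasFDerivAt
  have e5 := HasFDerivAt.comp (f := fun y => (c (x, y), x)) p e4 (e1.prodMk (hasFDerivAt_const x p))
  have e6 : (fun y => m (c (x, y), x)) =ᶠ[𝓝 p] fun y => m (x, y) :=
    ((continuous_const.prodMk continuous_id).tendsto p : Filter.Tendsto (fun y : E => (x, y)) (𝓝 p)
      (𝓝 (x, p))).eventually h1
  simpa using! DFunLike.congr_fun (e5.unique (e2.congr_of_eventuallyEq e6)) Y

/-- From `(xyx⁻¹)x = xy`, differentiated in `y` and then in `x` at the unit: the derivative of `Ad`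
in direction `X`, plus `∂₂∂₁m (X, Y)`, equals `∂₁∂₂m (X, Y)`. Symmetry of the second derivative
turns the correction into the mixed derivative with `X` and `Y` exchanged. -/
lemma fderiv_fderiv_conj {m c : E × E → E} {p : E} (hm : ContDiffAt ℝ ∞ m (p, p))
    (hc : ContDiffAt ℝ ∞ c (p, p)) (hcp : ∀ x, c (x, p) = p)
    (hmc : ∀ᶠ z in 𝓝 (p, p), m (c z, z.1) = m z)
    (hml : ∀ Z : E, fderiv ℝ m (p, p) (Z, (0 : E)) = Z)
    (hc1 : ∀ Z : E, fderiv ℝ c (p, p) ((0 : E), Z) = Z) (X Y : E) :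
    fderiv ℝ (fun x => fderiv ℝ c (x, p) ((0 : E), Y)) p X =
      fderiv ℝ (fderiv ℝ m) (p, p) (X, (0 : E)) ((0 : E), Y) -
        fderiv ℝ (fderiv ℝ m) (p, p) (Y, (0 : E)) ((0 : E), X) := by
  have hl := hasFDerivAt_fderiv_right hm (hasFDerivAt_fderiv_left hc Y).differentiableAt
  have hr := hasFDerivAt_fderiv_left hm Y
  have hu := DFunLike.congr_fun
    (hl.unique (hr.congr_of_eventuallyEq (eventually_fderiv_mul_conj hm hc hcp hmc Y))) X
  have hsymm := (hm.isSymmSndFDerivAt (by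
    rw [minSmoothness_of_isRCLikeNormedField]
    exact WithTop.coe_le_coe.2 (le_top : (2 : ℕ∞) ≤ ⊤))) ((0 : E), X) (Y, (0 : E))
  simp [hml, hc1] at hu
  rw [← hu, ← hsymm]
  simp

lemma lieBracketWithin_univ_eq_of_eventuallyEq {V W V' W' : E → E} {DV DW : E →L[ℝ] E} {p v w : E}
    (hV' : HasFDerivAt V' DV p) (hW' : HasFDerivAt W' DW p) (hV : V =ᶠ[𝓝 p] V')
    (hW : W =ᶠ[𝓝 p] W') (hv : V' p = v) (hw : W' p = w) :
    VectorField.lieBracketWithin ℝ V W Set.univ p = DW v - DV w := by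
  rw [VectorField.lieBracketWithin_univ, VectorField.lieBracket_eq]
  beta_reduce
  rw [(hV'.congr_of_eventuallyEq hV).fderiv, (hW'.congr_of_eventuallyEq hW).fderiv,
    hV.self_of_nhds, hW.self_of_nhds, hv, hw]

end ChartCalculus

/-! ### The derivative of the adjoint action is the bracket. -/

section AdjointDerivative

variable {E : Type*} [NormedAddCommGroup E] [NormedSpace ℝ E]
  {G : Type*} [TopologicalSpace G] [ChartedSpace E G] [Group G]

/-- The tautological identification of the Lie algebra with the model space, which carries a
norm. -/
def toModel : GroupLieAlgebra 𝓘(ℝ, E) G →L[ℝ] E :=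
  ContinuousLinearMap.id ℝ E

lemma chartConj_chartOne (x : E) : chartConj E G (x, chartOne E G) = chartOne E G := by
  simp only [chartConj, inChart, symm_chartOne, mul_one, mul_inv_cancel]
  rfl

/-- The velocity at `0` of a curve through `1`, in the chart at `1`. -/
lemma hasDerivAt_chart_of_hasMFDerivAt {X : E} {γ : ℝ → G} (h0 : γ 0 = 1)
    (hγ : HasMFDerivAt 𝓘(ℝ, ℝ) 𝓘(ℝ, E) γ 0 (ContinuousLinearMap.toSpanSingleton ℝ X)) :
    HasDerivAt (fun t => extChartAt 𝓘(ℝ, E) (1 : G) (γ t)) X 0 := by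
  have h : HasFDerivWithinAt (writtenInExtChartAt 𝓘(ℝ, ℝ) 𝓘(ℝ, E) 0 γ : ℝ → E)
    (ContinuousLinearMap.toSpanSingleton ℝ X) (Set.range 𝓘(ℝ, ℝ)) (0 : ℝ) := hγ.2
  rw [writtenInExtChartAt, h0, modelWithCornersSelf_coe, Set.range_id, hasFDerivWithinAt_univ] at h
  have h' := h.hasDerivAt
  rw [ContinuousLinearMap.toSpanSingleton_apply, one_smul] at h'
  exact h'

variable [LieGroup 𝓘(ℝ, E) ∞ G]

lemma fderiv_chartMul_chartOne_right (Y : E) :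
    fderiv ℝ (chartMul E G) (chartOne E G, chartOne E G) ((0 : E), Y) = Y := by
  have hd := (contDiffAt_chartMul (E := E) (G := G)).differentiableAt (by simp)
  have h := hasFDerivAt_inChart_snd hd
  have h' : HasFDerivAt (fun y => chartMul E G (chartOne E G, y)) (ContinuousLinearMap.id ℝ E)
      (chartOne E G) := by
    refine (hasFDerivAt_id _).congr_of_eventuallyEq ?_
    filter_upwards [target_mem_nhds_chartOne (E := E) (G := G)] with y hy
    simp only [chartMul, inChart, symm_chartOne, one_mul, id]
    exact (extChartAt 𝓘(ℝ, E) (1 : G)).right_inv hy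
  exact DFunLike.congr_fun (h.unique h') Y

lemma fderiv_chartMul_chartOne_left (Y : E) :
    fderiv ℝ (chartMul E G) (chartOne E G, chartOne E G) (Y, (0 : E)) = Y := by
  have hd := (contDiffAt_chartMul (E := E) (G := G)).differentiableAt (by simp)
  have h := HasFDerivAt.comp (f := fun x : E => (x, chartOne E G)) (chartOne E G) hd.hasFDerivAt
    (hasFDerivAt_prodMk_left (𝕜 := ℝ) (chartOne E G) (chartOne E G))
  have h' : HasFDerivAt (fun y => chartMul E G (y, chartOne E G)) (ContinuousLinearMap.id ℝ E)
      (chartOne E G) := by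
    refine (hasFDerivAt_id _).congr_of_eventuallyEq ?_
    filter_upwards [target_mem_nhds_chartOne (E := E) (G := G)] with y hy
    simp only [chartMul, inChart, symm_chartOne, mul_one, id]
    exact (extChartAt 𝓘(ℝ, E) (1 : G)).right_inv hy
  exact DFunLike.congr_fun (h.unique h') Y

lemma fderiv_chartConj_chartOne_right (Y : E) :
    fderiv ℝ (chartConj E G) (chartOne E G, chartOne E G) ((0 : E), Y) = Y := by
  have hd := (contDiffAt_chartConj (E := E) (G := G)).differentiableAt (by simp)
  have h := hasFDerivAt_inChart_snd hd
  have h' : HasFDerivAt (fun y => chartConj E G (chartOne E G, y)) (ContinuousLinearMap.id ℝ E)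
      (chartOne E G) := by
    refine (hasFDerivAt_id _).congr_of_eventuallyEq ?_
    filter_upwards [target_mem_nhds_chartOne (E := E) (G := G)] with y hy
    simp only [chartConj, inChart, symm_chartOne, one_mul, inv_one, mul_one, id]
    exact (extChartAt 𝓘(ℝ, E) (1 : G)).right_inv hy
  exact DFunLike.congr_fun (h.unique h') Y

/-- In the chart the left invariant field of `Y` is `x ↦ ∂₂m(x, p) Y`, with value `Y` at the unit
`p`. The bracket `DW·V - DV·W` of two such fields is therefore the antisymmetrised mixed second
derivative of `m`. -/
lemma lie_eq_chartMul (X Y : GroupLieAlgebra 𝓘(ℝ, E) G) :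
    ((⁅X, Y⁆ : GroupLieAlgebra 𝓘(ℝ, E) G) : E) =
      fderiv ℝ (fderiv ℝ (chartMul E G)) (chartOne E G, chartOne E G) ((X : E), (0 : E))
          ((0 : E), (Y : E)) -
        fderiv ℝ (fderiv ℝ (chartMul E G)) (chartOne E G, chartOne E G) ((Y : E), (0 : E))
          ((0 : E), (X : E)) := by
  have : IsManifold 𝓘(ℝ, E) ∞ G := LieGroup.toContMDiffMul.toIsManifold
  have : IsManifold 𝓘(ℝ, E) 1 G := IsManifold.of_le (n := ∞) (by exact_mod_cast le_top)
  have key (Z : GroupLieAlgebra 𝓘(ℝ, E) G) :=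
    eventually_mpullbackWithin_mulInvariantVectorField Z
  have hf (Z : E) := hasFDerivAt_fderiv_left (contDiffAt_chartMul (E := E) (G := G)) Z
  -- The preferred chart has identity derivative at its own base point, so the pullback in the
  -- definition of the bracket does nothing.
  have hinv : (mfderiv 𝓘(ℝ, E) 𝓘(ℝ, E) (extChartAt 𝓘(ℝ, E) (1 : G)) 1 : E →L[ℝ] E).inverse =
      ContinuousLinearMap.id ℝ E :=
    (congrArg (fun D : E →L[ℝ] E => D.inverse) mfderiv_extChartAt_self).trans
      ContinuousLinearMap.inverse_id
  rw [GroupLieAlgebra.bracket_def, ← VectorField.mlieBracketWithin_univ,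
    VectorField.mlieBracketWithin_apply]
  refine (DFunLike.congr_fun hinv _).trans ?_
  have hu : ((extChartAt 𝓘(ℝ, E) (1 : G)).symm ⁻¹' Set.univ ∩ Set.range 𝓘(ℝ, E)) = Set.univ := by
    simp
  rw [hu]
  exact lieBracketWithin_univ_eq_of_eventuallyEq (hf X) (hf Y) (key X) (key Y)
    (fderiv_chartMul_chartOne_right _) (fderiv_chartMul_chartOne_right _)

/-- The group identity `(xyx⁻¹)x = xy` survives in the chart only while `xyx⁻¹` stays in its source,
which continuity guarantees near the unit. -/
lemma eventually_chartMul_chartConj :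
    ∀ᶠ z : E × E in 𝓝 (chartOne E G, chartOne E G),
      chartMul E G (chartConj E G z, z.1) = chartMul E G z := by
  have hs := tendsto_symm_chartOne (E := E) (G := G)
  have hc : Filter.Tendsto (fun z : E × E => (extChartAt 𝓘(ℝ, E) (1 : G)).symm z.1 *
      (extChartAt 𝓘(ℝ, E) (1 : G)).symm z.2 * ((extChartAt 𝓘(ℝ, E) (1 : G)).symm z.1)⁻¹)
      (𝓝 (chartOne E G, chartOne E G)) (𝓝 1) := by
    have : IsTopologicalGroup G := topologicalGroup_of_lieGroup 𝓘(ℝ, E) ∞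
    have h1 := hs.comp (continuous_fst.tendsto (chartOne E G, chartOne E G))
    have h2 := hs.comp (continuous_snd.tendsto (chartOne E G, chartOne E G))
    simpa only [mul_one, inv_one] using! (h1.mul h2).mul h1.inv
  filter_upwards [hc (source_mem_nhds_one (E := E))] with z hz
  simp only [chartMul, chartConj, inChart]
  rw [(extChartAt 𝓘(ℝ, E) (1 : G)).left_inv hz, inv_mul_cancel_right]

/-- The derivative at `1` of the adjoint action, in the chart at `1`. -/
lemma fderiv_fderiv_chartConj (X Y : GroupLieAlgebra 𝓘(ℝ, E) G) :
    fderiv ℝ (fun x => fderiv ℝ (chartConj E G) (x, chartOne E G) ((0 : E), (Y : E)))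
      (chartOne E G) (X : E) = ((⁅X, Y⁆ : GroupLieAlgebra 𝓘(ℝ, E) G) : E) := by
  rw [lie_eq_chartMul]
  exact fderiv_fderiv_conj contDiffAt_chartMul contDiffAt_chartConj chartConj_chartOne
    eventually_chartMul_chartConj fderiv_chartMul_chartOne_left fderiv_chartConj_chartOne_right _ _

/-- If `γ` passes through `1` with velocity `X`, the derivative of `Ad (γ t) Y` is `[X, Y]`. -/
lemma hasDerivAt_Ad_of_hasMFDerivAt {X : GroupLieAlgebra 𝓘(ℝ, E) G} {γ : ℝ → G} (h0 : γ 0 = 1)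
    (hγ : HasMFDerivAt 𝓘(ℝ, ℝ) 𝓘(ℝ, E) γ 0 (ContinuousLinearMap.toSpanSingleton ℝ (X : E)))
    (Y : GroupLieAlgebra 𝓘(ℝ, E) G) :
    HasDerivAt (fun t => toModel (Ad (γ t) Y)) (toModel ⁅X, Y⁆) 0 := by
  have hγc : Filter.Tendsto γ (𝓝 0) (𝓝 1) := h0 ▸ hγ.1
  have h1 := hasDerivAt_chart_of_hasMFDerivAt h0 hγ
  have h4 : extChartAt 𝓘(ℝ, E) (1 : G) (γ 0) = chartOne E G := by rw [h0]; rfl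
  have h3 := (hasFDerivAt_fderiv_left
    (contDiffAt_chartConj (E := E) (G := G)) (Y : E)).differentiableAt.hasFDerivAt
  rw [← h4] at h3
  have h5 := h3.comp_hasDerivAt 0 h1
  rw [h4, fderiv_fderiv_chartConj] at h5
  refine h5.congr_of_eventuallyEq ?_
  have h6 : Filter.Tendsto (fun t => extChartAt 𝓘(ℝ, E) (1 : G) (γ t)) (𝓝 0)
      (𝓝 (chartOne E G)) := by
    have := h1.continuousAt
    rwa [ContinuousAt, h4] at this
  filter_upwards [h6.eventually (eventually_Ad_eq_fderiv_chartConj Y),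
    hγc (source_mem_nhds_one (E := E))] with t ht hts
  rw [(extChartAt 𝓘(ℝ, E) (1 : G)).left_inv hts] at ht
  exact ht

end AdjointDerivative

/-! ### The adjoint representation along one-parameter subgroups. -/

section Adjoint

variable {E : Type*} [NormedAddCommGroup E] [NormedSpace ℝ E]
  {G : Type*} [TopologicalSpace G] [ChartedSpace E G] [Group G] [LieGroup 𝓘(ℝ, E) ∞ G]

lemma isManifold_one_of_lieGroup : IsManifold 𝓘(ℝ, E) 1 G := by
  have : IsManifold 𝓘(ℝ, E) ∞ G := LieGroup.toContMDiffMul.toIsManifold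
  exact IsManifold.of_le (n := ∞) (by exact_mod_cast le_top)

lemma Ad_mul_apply (g h : G) (Y : GroupLieAlgebra 𝓘(ℝ, E) G) : Ad (g * h) Y = Ad g (Ad h Y) := by
  have h1 : HasMFDerivAt 𝓘(ℝ, E) 𝓘(ℝ, E) (fun x : G => g * x * g⁻¹) (h * 1 * h⁻¹)
      (Ad g : GroupLieAlgebra 𝓘(ℝ, E) G →L[ℝ] GroupLieAlgebra 𝓘(ℝ, E) G) := by
    rw [mul_one, mul_inv_cancel]
    exact hasMFDerivAt_Ad g
  have h2 := h1.comp (1 : G) (hasMFDerivAt_Ad h)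
  have h3 : ((fun x : G => g * x * g⁻¹) ∘ fun x : G => h * x * h⁻¹) =
      fun x : G => g * h * x * (g * h)⁻¹ := by
    funext x
    simp only [Function.comp_apply]
    group
  rw [h3] at h2
  exact DFunLike.congr_fun (hasMFDerivAt_unique (hasMFDerivAt_Ad (g * h)) h2) Y

lemma Ad_one_apply (Y : GroupLieAlgebra 𝓘(ℝ, E) G) : Ad (1 : G) Y = Y := by
  have h : HasMFDerivAt 𝓘(ℝ, E) 𝓘(ℝ, E) (fun x : G => (1 : G) * x * (1 : G)⁻¹) 1
      (ContinuousLinearMap.id ℝ (GroupLieAlgebra 𝓘(ℝ, E) G)) := by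
    have h1 : (fun x : G => (1 : G) * x * (1 : G)⁻¹) = id := by
      funext x
      simp
    rw [h1]
    exact hasMFDerivAt_id (I := 𝓘(ℝ, E)) (1 : G)
  exact DFunLike.congr_fun (hasMFDerivAt_unique (hasMFDerivAt_Ad (1 : G)) h) Y

lemma Ad_Ad_inv_apply (g : G) (Y : GroupLieAlgebra 𝓘(ℝ, E) G) : Ad g (Ad g⁻¹ Y) = Y := by
  rw [← Ad_mul_apply, mul_inv_cancel, Ad_one_apply]

namespace IsOneParameterSubgroup

variable {X : GroupLieAlgebra 𝓘(ℝ, E) G} {γ : ℝ → G}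

lemma map_neg {E : Type*} [NormedAddCommGroup E] [NormedSpace ℝ E]
    {G : Type*} [TopologicalSpace G] [ChartedSpace E G] [Group G]
    {X : GroupLieAlgebra 𝓘(ℝ, E) G} {γ : ℝ → G} (hγ : IsOneParameterSubgroup X γ) (t : ℝ) :
    γ (-t) = (γ t)⁻¹ := by
  rw [eq_inv_iff_mul_eq_one, ← hγ.map_add, neg_add_cancel, hγ.map_zero]

/-- Transport of the derivative at `0` by `Ad (γ s) = Ad (γ t) ∘ Ad (γ (s - t))`. This form suits
eigenvectors of `ad X`, where the bracket is known at `Y` itself. -/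
lemma hasDerivAt_Ad_lie (hγ : IsOneParameterSubgroup X γ) (Y : GroupLieAlgebra 𝓘(ℝ, E) G) (t : ℝ) :
    HasDerivAt (fun s => toModel (Ad (γ s) Y))
      (toModel (Ad (γ t) ⁅X, Y⁆)) t := by
  have h := hasDerivAt_Ad_of_hasMFDerivAt hγ.map_zero hγ.velocity Y
  have h1 : HasDerivAt (fun s => toModel (Ad (γ (s - t)) Y))
      (toModel (⁅X, Y⁆)) t := by
    rw [← sub_self t] at h
    exact h.comp_sub_const t t
  have h2 := HasFDerivAt.comp_hasDerivAt (E := E) (F := E) t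
    (ContinuousLinearMap.hasFDerivAt (E := E) (F := E) (Ad (γ t))) h1
  refine h2.congr_of_eventuallyEq (Filter.Eventually.of_forall fun s => ?_)
  change Ad (γ s) Y = Ad (γ t) (Ad (γ (s - t)) Y)
  rw [← Ad_mul_apply, ← hγ.map_add, add_sub_cancel]

/-- The other factorisation, `Ad (γ s) = Ad (γ (s - t)) ∘ Ad (γ t)`, leaves the bracket with `X`
outside; this suits `X ∈ 𝓗_μ`, where `μ` kills `[X, ·]` on `𝓗`. -/
lemma hasDerivAt_lie_Ad (hγ : IsOneParameterSubgroup X γ) (Y : GroupLieAlgebra 𝓘(ℝ, E) G) (t : ℝ) :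
    HasDerivAt (fun s => toModel (Ad (γ s) Y))
      (toModel (⁅X, Ad (γ t) Y⁆)) t := by
  have h := hasDerivAt_Ad_of_hasMFDerivAt hγ.map_zero hγ.velocity (Ad (γ t) Y)
  have h1 : HasDerivAt (fun s => toModel (Ad (γ (s - t)) (Ad (γ t) Y)))
      (toModel (⁅X, Ad (γ t) Y⁆)) t := by
    rw [← sub_self t] at h
    exact h.comp_sub_const t t
  refine h1.congr_of_eventuallyEq (Filter.Eventually.of_forall fun s => ?_)
  change Ad (γ s) Y = Ad (γ (s - t)) (Ad (γ t) Y)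
  rw [← Ad_mul_apply, ← hγ.map_add, sub_add_cancel]

/-- `Ad (exp (tX))` acts on an eigenvector of `ad X` by the exponential of the eigenvalue. -/
lemma Ad_apply_of_lie_eq_smul (hγ : IsOneParameterSubgroup X γ) {Y : GroupLieAlgebra 𝓘(ℝ, E) G}
    {c : ℝ} (hY : ⁅X, Y⁆ = c • Y) (t : ℝ) : Ad (γ t) Y = Real.exp (c * t) • Y := by
  have h1 (s : ℝ) : HasDerivAt (fun s => toModel (Ad (γ s) Y)) (c • toModel (Ad (γ s) Y)) s := by
    have h := hγ.hasDerivAt_Ad_lie Y s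
    rwa [hY, ContinuousLinearMap.map_smul, ContinuousLinearMap.map_smul] at h
  -- The integrating factor makes the solution of `u' = c u` constant.
  have h2 (s : ℝ) : HasDerivAt (fun s => Real.exp (-(c * s)) • toModel (Ad (γ s) Y)) 0 s := by
    have h3 : HasDerivAt (fun s : ℝ => Real.exp (-(c * s))) (Real.exp (-(c * s)) * -(c * 1)) s :=
      ((hasDerivAt_id s).const_mul c).neg.exp
    refine (h3.smul (h1 s)).congr_deriv ?_
    rw [smul_smul, ← add_smul]
    convert zero_smul ℝ _ using 2
    ring
  have h5 := is_const_of_deriv_eq_zero (fun s => (h2 s).differentiableAt) (fun s => (h2 s).deriv)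
    t 0
  simp only [hγ.map_zero, Ad_one_apply, mul_zero, neg_zero, Real.exp_zero, one_smul] at h5
  change toModel (Ad (γ t) Y) = Real.exp (c * t) • toModel Y
  rw [← h5, smul_smul, ← Real.exp_add, add_neg_cancel, Real.exp_zero, one_smul]

lemma Ad_apply_of_lie_eq_zero (hγ : IsOneParameterSubgroup X γ) {Y : GroupLieAlgebra 𝓘(ℝ, E) G}
    (hY : ⁅X, Y⁆ = 0) (t : ℝ) : Ad (γ t) Y = Y := by
  have h := hγ.Ad_apply_of_lie_eq_smul (c := 0) (by rw [hY, zero_smul]) t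
  rwa [zero_mul, Real.exp_zero, one_smul] at h

lemma isMIntegralCurve (hγ : IsOneParameterSubgroup X γ) :
    IsMIntegralCurve γ (mulInvariantVectorField X) := by
  intro t
  have h1 : HasMFDerivAt 𝓘(ℝ, ℝ) 𝓘(ℝ, ℝ) (fun s : ℝ => s - t) t (ContinuousLinearMap.id ℝ ℝ) :=
    ((hasFDerivAt_id t).sub_const t).hasMFDerivAt
  have h2 : HasMFDerivAt 𝓘(ℝ, ℝ) 𝓘(ℝ, E) γ (t - t)
      (ContinuousLinearMap.toSpanSingleton ℝ (X : E)) := by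
    rw [sub_self]
    exact hγ.velocity
  have h3 : HasMFDerivAt 𝓘(ℝ, E) 𝓘(ℝ, E) (fun x : G => γ t * x) (γ (t - t))
      (mfderiv 𝓘(ℝ, E) 𝓘(ℝ, E) (fun x : G => γ t * x) 1 : E →L[ℝ] E) := by
    rw [sub_self, hγ.map_zero]
    exact ((contMDiff_mul_left (I := 𝓘(ℝ, E)) (n := ∞) (a := γ t)).mdifferentiableAt
      (by simp)).hasMFDerivAt
  have h4 := h3.comp t (HasMFDerivAt.comp (f := fun s : ℝ => s - t) t h2 h1)
  have h5 : ((fun x : G => γ t * x) ∘ γ ∘ fun s : ℝ => s - t) = γ := by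
    funext s
    simp only [Function.comp_apply]
    rw [← hγ.map_add, add_sub_cancel]
  rw [h5] at h4
  refine (congrArg (HasMFDerivAt 𝓘(ℝ, ℝ) 𝓘(ℝ, E) γ t) ?_).mp h4
  refine ContinuousLinearMap.ext_ring ?_
  change (mfderiv 𝓘(ℝ, E) 𝓘(ℝ, E) (fun x : G => γ t * x) 1 : E →L[ℝ] E) ((1 : ℝ) • (X : E)) =
    (1 : ℝ) • (mfderiv 𝓘(ℝ, E) 𝓘(ℝ, E) (fun x : G => γ t * x) 1 : E →L[ℝ] E) (X : E)
  rw [ContinuousLinearMap.map_smul]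

end IsOneParameterSubgroup

lemma contMDiff_one_mulInvariantVectorField (X : GroupLieAlgebra 𝓘(ℝ, E) G) :
    ContMDiff 𝓘(ℝ, E) 𝓘(ℝ, E).tangent 1
      (fun g : G => (⟨g, mulInvariantVectorField X g⟩ : TangentBundle 𝓘(ℝ, E) G)) :=
  (contMDiff_mulInvariantVectorField X).of_le (by
    rw [minSmoothness_of_isRCLikeNormedField]
    exact one_le_two)

/-- A left translate of an integral curve of a left invariant vector field is again one. -/
lemma isMIntegralCurveOn_mul_left {X : GroupLieAlgebra 𝓘(ℝ, E) G} {γ : ℝ → G} {s : Set ℝ}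
    (hγ : IsMIntegralCurveOn γ (mulInvariantVectorField X) s) (g : G) :
    IsMIntegralCurveOn (fun t => g * γ t) (mulInvariantVectorField X) s := by
  intro t ht
  have h1 : HasMFDerivAt 𝓘(ℝ, E) 𝓘(ℝ, E) (fun x : G => g * x) (γ t)
      (mfderiv 𝓘(ℝ, E) 𝓘(ℝ, E) (fun x : G => g * x) (γ t)) :=
    ((contMDiff_mul_left (I := 𝓘(ℝ, E)) (n := ∞) (a := g)).mdifferentiableAt
      (by simp)).hasMFDerivAt
  have h2 := h1.comp_hasMFDerivWithinAt t (hγ t ht)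
  refine (congrArg (HasMFDerivWithinAt 𝓘(ℝ, ℝ) 𝓘(ℝ, E) (fun t => g * γ t) s t) ?_).mp h2
  refine ContinuousLinearMap.ext_ring ?_
  have h3 : HasMFDerivAt 𝓘(ℝ, E) 𝓘(ℝ, E) (fun x : G => γ t * x) 1
      (mfderiv 𝓘(ℝ, E) 𝓘(ℝ, E) (fun x : G => γ t * x) 1) :=
    ((contMDiff_mul_left (I := 𝓘(ℝ, E)) (n := ∞) (a := γ t)).mdifferentiableAt
      (by simp)).hasMFDerivAt
  have h4 : HasMFDerivAt 𝓘(ℝ, E) 𝓘(ℝ, E) (fun x : G => g * x) (γ t * 1)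
      (mfderiv 𝓘(ℝ, E) 𝓘(ℝ, E) (fun x : G => g * x) (γ t) : E →L[ℝ] E) := by
    rw [mul_one]
    exact h1
  have h5 := h4.comp (1 : G) h3
  have h6 : ((fun x : G => g * x) ∘ fun x : G => γ t * x) = fun x : G => g * γ t * x := by
    funext x
    simp only [Function.comp_apply, mul_assoc]
  rw [h6] at h5
  have h7 : HasMFDerivAt 𝓘(ℝ, E) 𝓘(ℝ, E) (fun x : G => g * γ t * x) 1
      (mfderiv 𝓘(ℝ, E) 𝓘(ℝ, E) (fun x : G => g * γ t * x) 1) := h5.mdifferentiableAt.hasMFDerivAt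
  have h8 := DFunLike.congr_fun (hasMFDerivAt_unique h7 h5) (X : E)
  change (mfderiv 𝓘(ℝ, E) 𝓘(ℝ, E) (fun x : G => g * x) (γ t) : E →L[ℝ] E)
    ((1 : ℝ) • (mfderiv 𝓘(ℝ, E) 𝓘(ℝ, E) (fun x : G => γ t * x) 1 : E →L[ℝ] E) (X : E)) =
    (1 : ℝ) • (mfderiv 𝓘(ℝ, E) 𝓘(ℝ, E) (fun x : G => g * γ t * x) 1 : E →L[ℝ] E) (X : E)
  rw [one_smul, one_smul]
  exact h8.symm

/-! ### Existence and uniqueness of one-parameter subgroups. -/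

section Existence

variable [T2Space G]

lemma IsOneParameterSubgroup.unique {X : GroupLieAlgebra 𝓘(ℝ, E) G} {γ γ' : ℝ → G}
    (hγ : IsOneParameterSubgroup X γ) (hγ' : IsOneParameterSubgroup X γ') : γ = γ' := by
  have := isManifold_one_of_lieGroup (E := E) (G := G)
  exact isMIntegralCurve_Ioo_eq_of_contMDiff_boundaryless (t₀ := 0)
    (contMDiff_one_mulInvariantVectorField X) hγ.isMIntegralCurve hγ'.isMIntegralCurve
    (hγ.map_zero.trans hγ'.map_zero.symm)

lemma exists_isOneParameterSubgroup [CompleteSpace E] (X : GroupLieAlgebra 𝓘(ℝ, E) G) :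
    ∃ γ : ℝ → G, IsOneParameterSubgroup X γ := by
  have := isManifold_one_of_lieGroup (E := E) (G := G)
  have hX := contMDiff_one_mulInvariantVectorField X
  obtain ⟨γ₁, h1, hγ₁⟩ :=
    exists_isMIntegralCurveAt_of_contMDiffAt_boundaryless 0 (hX.contMDiffAt (x := 1))
  obtain ⟨ε, hε, hγ₁⟩ := isMIntegralCurveAt_iff'.mp hγ₁
  rw [Real.ball_eq_Ioo, zero_sub, zero_add] at hγ₁
  -- Left translates of the local solution through `1` give solutions through every point on the
  -- same interval; this uniform `ε` makes the field complete.
  obtain ⟨γ, h0, hγ⟩ := exists_isMIntegralCurve_of_isMIntegralCurveOn hX hε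
    (fun g => ⟨fun t => g * γ₁ t, by simp only [h1, mul_one], isMIntegralCurveOn_mul_left hγ₁ g⟩) 1
  refine ⟨γ, h0, fun s t => ?_, ?_⟩
  -- Both `t ↦ γ (t + s)` and `t ↦ γ s * γ t` are integral curves through `γ s`, so uniqueness gives
  -- the homomorphism property.
  · have h2 := hγ.comp_add s
    have h3 : IsMIntegralCurve (fun t => γ s * γ t) (mulInvariantVectorField X) := by
      rw [isMIntegralCurve_iff_isMIntegralCurveOn]
      exact isMIntegralCurveOn_mul_left (isMIntegralCurve_iff_isMIntegralCurveOn.mp hγ) (γ s)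
    have h4 := isMIntegralCurve_Ioo_eq_of_contMDiff_boundaryless (t₀ := 0) hX h2 h3 (by simp [h0])
    rw [add_comm]
    exact congrFun h4 t
  · have h2 := hγ 0
    refine (congrArg (HasMFDerivAt 𝓘(ℝ, ℝ) 𝓘(ℝ, E) γ 0) ?_).mp h2
    refine ContinuousLinearMap.ext_ring ?_
    have h3 : mulInvariantVectorField X (1 : G) = X := by
      have h4 : HasMFDerivAt 𝓘(ℝ, E) 𝓘(ℝ, E) (fun x : G => (1 : G) * x) 1
          (ContinuousLinearMap.id ℝ (TangentSpace 𝓘(ℝ, E) (1 : G))) := by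
        have h5 : (fun x : G => (1 : G) * x) = id := by
          funext x
          exact one_mul x
        rw [h5]
        exact hasMFDerivAt_id (I := 𝓘(ℝ, E)) (1 : G)
      exact DFunLike.congr_fun h4.mfderiv X
    change (1 : ℝ) • (mulInvariantVectorField X (γ 0) : E) = (1 : ℝ) • (X : E)
    rw [h0]
    exact congrArg _ h3

end Existence

end Adjoint

/-! ### Images and products of one-parameter subgroups. -/

section OneParameter

variable {E : Type*} [NormedAddCommGroup E] [NormedSpace ℝ E]
  {G : Type*} [TopologicalSpace G] [ChartedSpace E G] [Group G]

lemma IsOneParameterSubgroup.map {X X' : GroupLieAlgebra 𝓘(ℝ, E) G} {γ : ℝ → G}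
    (hγ : IsOneParameterSubgroup X γ) (f : G →* G)
    {D : GroupLieAlgebra 𝓘(ℝ, E) G →L[ℝ] GroupLieAlgebra 𝓘(ℝ, E) G}
    (hf : HasMFDerivAt 𝓘(ℝ, E) 𝓘(ℝ, E) f 1 (D : E →L[ℝ] E)) (hX : D X = X') :
    IsOneParameterSubgroup X' (fun t => f (γ t)) where
  map_zero := by rw [hγ.map_zero, map_one]
  map_add s t := by rw [hγ.map_add, map_mul]
  velocity := by
    have h1 : HasMFDerivAt 𝓘(ℝ, E) 𝓘(ℝ, E) f (γ 0) (D : E →L[ℝ] E) := by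
      rw [hγ.map_zero]
      exact hf
    have h2 := h1.comp (0 : ℝ) hγ.velocity
    refine (congrArg (HasMFDerivAt 𝓘(ℝ, ℝ) 𝓘(ℝ, E) (fun t => f (γ t)) 0) ?_).mp h2
    refine ContinuousLinearMap.ext_ring ?_
    change (D : E →L[ℝ] E) ((1 : ℝ) • (X : E)) = (1 : ℝ) • (X' : E)
    rw [one_smul, one_smul]
    exact hX

lemma IsOneParameterSubgroup.comp_mul {X : GroupLieAlgebra 𝓘(ℝ, E) G} {γ : ℝ → G}
    (hγ : IsOneParameterSubgroup X γ) (c : ℝ) :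
    IsOneParameterSubgroup (c • X) (fun t => γ (c * t)) where
  map_zero := by rw [mul_zero, hγ.map_zero]
  map_add s t := by rw [mul_add, hγ.map_add]
  velocity := by
    have h1 : HasMFDerivAt 𝓘(ℝ, ℝ) 𝓘(ℝ, ℝ) (fun t : ℝ => c * t) 0
        (ContinuousLinearMap.toSpanSingleton ℝ c) := by
      have h : HasDerivAt (fun t : ℝ => c * t) c 0 := by
        simpa using (hasDerivAt_id (0 : ℝ)).const_mul c
      exact h.hasFDerivAt.hasMFDerivAt
    have h2 : HasMFDerivAt 𝓘(ℝ, ℝ) 𝓘(ℝ, E) γ (c * 0)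
        (ContinuousLinearMap.toSpanSingleton ℝ (X : E)) := by
      rw [mul_zero]
      exact hγ.velocity
    have h3 := HasMFDerivAt.comp (f := fun t : ℝ => c * t) 0 h2 h1
    refine (congrArg (HasMFDerivAt 𝓘(ℝ, ℝ) 𝓘(ℝ, E) (fun t => γ (c * t)) 0) ?_).mp h3
    refine ContinuousLinearMap.ext_ring ?_
    change ((1 : ℝ) • c) • (X : E) = (1 : ℝ) • (c • (X : E))
    rw [one_smul, one_smul]

variable [LieGroup 𝓘(ℝ, E) ∞ G]

lemma IsOneParameterSubgroup.conj {X : GroupLieAlgebra 𝓘(ℝ, E) G} {γ : ℝ → G}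
    (hγ : IsOneParameterSubgroup X γ) (g : G) :
    IsOneParameterSubgroup (Ad g X) (fun t => g * γ t * g⁻¹) :=
  hγ.map (MulAut.conj g).toMonoidHom (D := Ad g) (hasMFDerivAt_Ad g) rfl

/-- The velocity of a product of curves through `1` is the sum of the velocities. -/
lemma hasMFDerivAt_mul_of_one {X Y : E} {γ δ : ℝ → G} (hγ0 : γ 0 = 1) (hδ0 : δ 0 = 1)
    (hγ : HasMFDerivAt 𝓘(ℝ, ℝ) 𝓘(ℝ, E) γ 0 (ContinuousLinearMap.toSpanSingleton ℝ X))
    (hδ : HasMFDerivAt 𝓘(ℝ, ℝ) 𝓘(ℝ, E) δ 0 (ContinuousLinearMap.toSpanSingleton ℝ Y)) :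
    HasMFDerivAt 𝓘(ℝ, ℝ) 𝓘(ℝ, E) (fun t => γ t * δ t) 0
      (ContinuousLinearMap.toSpanSingleton ℝ (X + Y)) := by
  have hd : MDifferentiableAt 𝓘(ℝ, ℝ) 𝓘(ℝ, E) (fun t => γ t * δ t) 0 :=
    MDifferentiableAt.comp (I' := 𝓘(ℝ, E).prod 𝓘(ℝ, E)) (f := fun t => (γ t, δ t))
      (g := fun z : G × G => z.1 * z.2) 0
      ((contMDiff_mul 𝓘(ℝ, E) ∞).mdifferentiableAt (by simp))
      (hγ.mdifferentiableAt.prodMk hδ.mdifferentiableAt)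
  have h := hd.hasMFDerivAt
  set D : ℝ →L[ℝ] E := mfderiv 𝓘(ℝ, ℝ) 𝓘(ℝ, E) (fun t => γ t * δ t) 0 with hD
  have hDZ : ContinuousLinearMap.toSpanSingleton ℝ (D 1) = D :=
    ContinuousLinearMap.ext_ring (by simp)
  have h' : HasMFDerivAt 𝓘(ℝ, ℝ) 𝓘(ℝ, E) (fun t => γ t * δ t) 0
      (ContinuousLinearMap.toSpanSingleton ℝ (D 1)) :=
    (congrArg (HasMFDerivAt 𝓘(ℝ, ℝ) 𝓘(ℝ, E) (fun t => γ t * δ t) 0) hDZ).mpr h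
  have e1 := hasDerivAt_chart_of_hasMFDerivAt (γ := fun t => γ t * δ t)
    (by simp only [hγ0, hδ0, mul_one]) h'
  have e2 := hasDerivAt_chart_of_hasMFDerivAt hγ0 hγ
  have e3 := hasDerivAt_chart_of_hasMFDerivAt hδ0 hδ
  have h4 : (extChartAt 𝓘(ℝ, E) (1 : G) (γ 0), extChartAt 𝓘(ℝ, E) (1 : G) (δ 0)) =
      (chartOne E G, chartOne E G) := by
    rw [hγ0, hδ0]
    rfl
  have hm := ((contDiffAt_chartMul (E := E) (G := G)).differentiableAt (by simp)).hasFDerivAt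
  rw [← h4] at hm
  have e4 := HasFDerivAt.comp_hasDerivAt 0 hm (e2.prodMk e3)
  rw [h4] at e4
  have e5 : (fun t => extChartAt 𝓘(ℝ, E) (1 : G) (γ t * δ t)) =ᶠ[𝓝 0] (chartMul E G ∘
      fun t => (extChartAt 𝓘(ℝ, E) (1 : G) (γ t), extChartAt 𝓘(ℝ, E) (1 : G) (δ t))) := by
    have c1 : Filter.Tendsto γ (𝓝 0) (𝓝 1) := hγ0 ▸ hγ.1
    have c2 : Filter.Tendsto δ (𝓝 0) (𝓝 1) := hδ0 ▸ hδ.1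
    filter_upwards [c1 (source_mem_nhds_one (E := E)), c2 (source_mem_nhds_one (E := E))]
      with t h1 h2
    simp only [Function.comp_apply, chartMul, inChart]
    rw [(extChartAt 𝓘(ℝ, E) (1 : G)).left_inv h1, (extChartAt 𝓘(ℝ, E) (1 : G)).left_inv h2]
  have hZ : D 1 = X + Y := by
    rw [e1.unique (e4.congr_of_eventuallyEq e5)]
    nth_rewrite 1 [← add_zero X, ← zero_add Y, ← Prod.mk_add_mk]
    rw [map_add, fderiv_chartMul_chartOne_left, fderiv_chartMul_chartOne_right]
  exact (congrArg (fun Z : E => HasMFDerivAt 𝓘(ℝ, ℝ) 𝓘(ℝ, E) (fun t => γ t * δ t) 0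
    (ContinuousLinearMap.toSpanSingleton ℝ Z)) hZ).mp h'

variable [T2Space G]

/-- One-parameter subgroups with commuting velocities commute. -/
lemma IsOneParameterSubgroup.commute {X Y : GroupLieAlgebra 𝓘(ℝ, E) G} {γ δ : ℝ → G}
    (hγ : IsOneParameterSubgroup X γ) (hδ : IsOneParameterSubgroup Y δ) (h : ⁅X, Y⁆ = 0)
    (s t : ℝ) : γ s * δ t = δ t * γ s := by
  -- Conjugating `δ` by `γ s` changes its velocity to `Ad (γ s) Y = Y`, so uniqueness returns `δ`.
  have h1 := hδ.conj (γ s)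
  rw [hγ.Ad_apply_of_lie_eq_zero h s] at h1
  have h2 := congrFun (h1.unique hδ) t
  exact mul_inv_eq_iff_eq_mul.mp h2

lemma IsOneParameterSubgroup.mul {X Y : GroupLieAlgebra 𝓘(ℝ, E) G} {γ δ : ℝ → G}
    (hγ : IsOneParameterSubgroup X γ) (hδ : IsOneParameterSubgroup Y δ) (h : ⁅X, Y⁆ = 0) :
    IsOneParameterSubgroup (X + Y) (fun t => γ t * δ t) where
  map_zero := by rw [hγ.map_zero, hδ.map_zero, mul_one]
  map_add s t := by
    rw [hγ.map_add, hδ.map_add, mul_assoc, ← mul_assoc (γ t), hγ.commute hδ h t s]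
    simp only [mul_assoc]
  velocity := hasMFDerivAt_mul_of_one hγ.map_zero hδ.map_zero hγ.velocity hδ.velocity

/-- Used with `X = q` and `Y ∈ 𝓐`, to see that `Q exp(tY)` stays in `A`, with known logarithm `q +
tY`. -/
lemma IsExp.mul_oneParameterSubgroup [CompleteSpace E] {X Y : GroupLieAlgebra 𝓘(ℝ, E) G} {g : G} {γ : ℝ → G}
    (hg : IsExp X g) (hγ : IsOneParameterSubgroup Y γ) (h : ⁅X, Y⁆ = 0) (t : ℝ) :
    IsExp (X + t • Y) (g * γ t) := by
  obtain ⟨δ, hδ, rfl⟩ := hg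
  refine ⟨fun s => δ s * γ (t * s), hδ.mul (hγ.comp_mul t) (by rw [lie_smul, h, smul_zero]), ?_⟩
  simp only [mul_one]

end OneParameter

/-! ### The involution on the group and on its Lie algebra. -/

section Involution

variable {E : Type*} [NormedAddCommGroup E] [NormedSpace ℝ E]
  {G : Type*} [TopologicalSpace G] [ChartedSpace E G] [Group G]
  {σ : G →* G}

lemma IsInvolution.hasMFDerivAt_dOne (hσ : IsInvolution E σ) :
    HasMFDerivAt 𝓘(ℝ, E) 𝓘(ℝ, E) σ 1
      ((dOne σ : GroupLieAlgebra 𝓘(ℝ, E) G →L[ℝ] GroupLieAlgebra 𝓘(ℝ, E) G) : E →L[ℝ] E) :=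
  (hσ.smooth.mdifferentiableAt (by simp)).hasMFDerivAt

lemma IsInvolution.dOne_dOne (hσ : IsInvolution E σ) (X : GroupLieAlgebra 𝓘(ℝ, E) G) :
    dOne σ (dOne σ X) = X := by
  have h1 : HasMFDerivAt 𝓘(ℝ, E) 𝓘(ℝ, E) σ (σ 1)
      ((dOne σ : GroupLieAlgebra 𝓘(ℝ, E) G →L[ℝ] GroupLieAlgebra 𝓘(ℝ, E) G) : E →L[ℝ] E) := by
    rw [map_one]
    exact hσ.hasMFDerivAt_dOne
  have h2 := h1.comp (1 : G) hσ.hasMFDerivAt_dOne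
  have h3 : (σ ∘ σ : G → G) = id := funext hσ.involutive
  rw [h3] at h2
  exact DFunLike.congr_fun (hasMFDerivAt_unique h2 (hasMFDerivAt_id (I := 𝓘(ℝ, E)) (1 : G))) X

lemma IsInvolution.isOneParameterSubgroup (hσ : IsInvolution E σ)
    {X : GroupLieAlgebra 𝓘(ℝ, E) G} {γ : ℝ → G} (hγ : IsOneParameterSubgroup X γ) :
    IsOneParameterSubgroup (dOne σ X) (fun t => σ (γ t)) :=
  hγ.map σ hσ.hasMFDerivAt_dOne rfl

variable [LieGroup 𝓘(ℝ, E) ∞ G]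

lemma IsInvolution.dOne_Ad (hσ : IsInvolution E σ) (g : G) (Y : GroupLieAlgebra 𝓘(ℝ, E) G) :
    dOne σ (Ad g Y) = Ad (σ g) (dOne σ Y) := by
  have h1 : HasMFDerivAt 𝓘(ℝ, E) 𝓘(ℝ, E) σ (g * 1 * g⁻¹)
      ((dOne σ : GroupLieAlgebra 𝓘(ℝ, E) G →L[ℝ] GroupLieAlgebra 𝓘(ℝ, E) G) : E →L[ℝ] E) := by
    rw [mul_one, mul_inv_cancel]
    exact hσ.hasMFDerivAt_dOne
  have h2 := h1.comp (1 : G) (hasMFDerivAt_Ad g)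
  have h3 : HasMFDerivAt 𝓘(ℝ, E) 𝓘(ℝ, E) (fun x : G => σ g * x * (σ g)⁻¹) (σ 1)
      ((Ad (σ g) : GroupLieAlgebra 𝓘(ℝ, E) G →L[ℝ] GroupLieAlgebra 𝓘(ℝ, E) G) : E →L[ℝ] E) := by
    rw [map_one]
    exact hasMFDerivAt_Ad (σ g)
  have h4 := h3.comp (1 : G) hσ.hasMFDerivAt_dOne
  have h5 : (σ ∘ fun x : G => g * x * g⁻¹) = (fun x : G => σ g * x * (σ g)⁻¹) ∘ σ := by
    funext x
    simp only [Function.comp_apply, map_mul, map_inv]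
  rw [h5] at h2
  exact DFunLike.congr_fun (hasMFDerivAt_unique h2 h4) Y

lemma IsInvolution.Ad_mem_hAlg (hσ : IsInvolution E σ) {h : G} (hh : h ∈ fixedSubgroup σ)
    {Y : GroupLieAlgebra 𝓘(ℝ, E) G} (hY : Y ∈ hAlg E σ) : Ad h Y ∈ hAlg E σ := by
  have hh' : σ h = h := hh
  have hY' : dOne σ Y = Y := hY
  change dOne σ (Ad h Y) = Ad h Y
  rw [hσ.dOne_Ad, hh', hY']

variable [T2Space G]

lemma IsInvolution.oneParameterSubgroup_mem_fixedSubgroup (hσ : IsInvolution E σ)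
    {X : GroupLieAlgebra 𝓘(ℝ, E) G} (hX : X ∈ hAlg E σ) {γ : ℝ → G}
    (hγ : IsOneParameterSubgroup X γ) (t : ℝ) : γ t ∈ fixedSubgroup σ := by
  have h := hσ.isOneParameterSubgroup hγ
  rw [show dOne σ X = X from hX] at h
  exact congrFun (h.unique hγ) t

variable [CompleteSpace E]

/-- Differentiate `σ (Ad (γ t) Y) = Ad (σ (γ t)) (σ Y)` at `t = 0`, where `σ ∘ γ` has velocity `σ
X`. -/
lemma IsInvolution.dOne_lie (hσ : IsInvolution E σ) (X Y : GroupLieAlgebra 𝓘(ℝ, E) G) :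
    dOne σ ⁅X, Y⁆ = ⁅dOne σ X, dOne σ Y⁆ := by
  obtain ⟨γ, hγ⟩ := exists_isOneParameterSubgroup X
  have h1 := HasFDerivAt.comp_hasDerivAt (E := E) (F := E) 0
    (ContinuousLinearMap.hasFDerivAt (E := E) (F := E) (dOne σ))
    (hasDerivAt_Ad_of_hasMFDerivAt hγ.map_zero hγ.velocity Y)
  have hσγ := hσ.isOneParameterSubgroup hγ
  have h2 := hasDerivAt_Ad_of_hasMFDerivAt hσγ.map_zero hσγ.velocity (dOne σ Y)
  exact h1.unique (h2.congr_of_eventuallyEq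
    (Filter.Eventually.of_forall fun t => hσ.dOne_Ad (γ t) Y))

variable [FiniteDimensional ℝ E]

/-- The derivative of `μ (Ad (γ s) Y)` is `μ [X, Ad (γ s) Y]`, which is zero because `Ad (γ s) Y`
stays in `𝓗`. -/
lemma IsInvolution.oneParameterSubgroup_mem_isotropyGroup (hσ : IsInvolution E σ)
    {μ : Module.Dual ℝ (GroupLieAlgebra 𝓘(ℝ, E) G)} {X : GroupLieAlgebra 𝓘(ℝ, E) G}
    (hX : X ∈ isotropyAlgebra σ μ) {γ : ℝ → G} (hγ : IsOneParameterSubgroup X γ) (t : ℝ) :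
    γ t ∈ isotropyGroup σ μ := by
  have hfix := hσ.oneParameterSubgroup_mem_fixedSubgroup hX.1 hγ
  refine ⟨hfix t, fun Y hY => ?_⟩
  set ν : E →L[ℝ] ℝ := LinearMap.toContinuousLinearMap (μ : E →ₗ[ℝ] ℝ) with hν
  have h1 (s : ℝ) : HasDerivAt (fun s => ν (toModel (Ad (γ s) Y))) 0 s := by
    have h2 := ν.hasFDerivAt.comp_hasDerivAt s (hγ.hasDerivAt_lie_Ad Y s)
    refine h2.congr_deriv ?_
    exact hX.2 _ (hσ.Ad_mem_hAlg (hfix s) hY)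
  -- The comparison is made at `-t` because the coadjoint action involves `(γ t)⁻¹`.
  have h2 := is_const_of_deriv_eq_zero (fun s => (h1 s).differentiableAt) (fun s => (h1 s).deriv)
    (-t) 0
  rw [hγ.map_neg, hγ.map_zero, Ad_one_apply] at h2
  exact h2

end Involution

/-! ### Coordinates and projections for direct sums. -/

section LinearAlgebra

variable {V : Type*} [AddCommGroup V] [Module ℝ V]

/-- The coordinates along a linearly independent family which spans a complement of `U`. -/
lemma exists_coord {κ : Type*} [DecidableEq κ] {v : κ → V} (hv : LinearIndependent ℝ v)
    {U : Submodule ℝ V} (hU : IsCompl U (Submodule.span ℝ (Set.range v))) :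
    ∃ f : κ → V →ₗ[ℝ] ℝ, (∀ i, ∀ Y ∈ U, f i Y = 0) ∧ ∀ i j, f i (v j) = if i = j then 1 else 0 := by
  refine ⟨fun i => (Finsupp.lapply i).comp (hv.repr.comp
    (Submodule.projectionOnto _ _ hU.symm)), fun i Y hY => ?_, fun i j => ?_⟩
  · have h : Submodule.projectionOnto _ _ hU.symm Y = 0 :=
      (Submodule.projectionOnto_apply_eq_zero_iff hU.symm).mpr hY
    simp [h]
  · have hj : v j ∈ Submodule.span ℝ (Set.range v) := Submodule.subset_span ⟨j, rfl⟩
    have h : Submodule.projectionOnto _ _ hU.symm (v j) = ⟨v j, hj⟩ :=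
      Submodule.projectionOnto_apply_left hU.symm ⟨v j, hj⟩
    simp only [LinearMap.comp_apply, h, hv.repr_eq_single j ⟨v j, hj⟩ rfl,
      Finsupp.lapply_apply, Finsupp.single_apply, eq_comm]

/-- The projection to the middle summand of a direct sum, extended to the whole space. -/
lemma IsDirectSum.exists_proj {T U V' W : Submodule ℝ V} (h : IsDirectSum T U V' W) :
    ∃ P : V →ₗ[ℝ] V', (∀ b : V', P b = b) ∧ ∀ X ∈ U ⊔ W, P X = 0 := by
  have h1 : Disjoint V' (U ⊔ W) :=
    h.disjoint_left.symm.disjoint_sup_right_of_disjoint_sup_left (by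
      rw [sup_comm]
      exact h.disjoint_right)
  -- As `T` may be proper, `U ⊔ W` is enlarged to a complement of `V'` in the whole space.
  obtain ⟨C, hC, hc⟩ := h1.symm.exists_isCompl
  refine ⟨Submodule.projectionOnto _ _ hc.symm, fun b => ?_, fun X hX => ?_⟩
  · exact Submodule.projectionOnto_apply_left _ b
  · exact (Submodule.projectionOnto_apply_eq_zero_iff _).mpr (hC hX)

/-- Inside `T` the kernel of `P` is exactly `U ⊔ W`. This supplies existence and uniqueness of the
element `b` that characterises `h₀`. -/
lemma IsDirectSum.sub_mem_iff {T U V' W : Submodule ℝ V} (h : IsDirectSum T U V' W)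
    {P : V →ₗ[ℝ] V'} (hP : ∀ b : V', P b = b) (hP0 : ∀ X ∈ U ⊔ W, P X = 0) {X : V} (hX : X ∈ T)
    (b : V') : (b : V) - X ∈ U ⊔ W ↔ b = P X := by
  constructor
  · intro hb
    have h1 := hP0 _ hb
    rw [map_sub, hP] at h1
    exact sub_eq_zero.mp h1
  · rintro rfl
    rw [← h.sup_eq, sup_right_comm] at hX
    obtain ⟨y, hy, b, hb, rfl⟩ := Submodule.mem_sup.mp hX
    rw [map_add, hP0 y hy, zero_add, hP ⟨b, hb⟩]
    change b - (y + b) ∈ U ⊔ W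
    rw [sub_add_cancel_right]
    exact neg_mem hy

end LinearAlgebra

/-! ### The root decomposition and the two eigenspaces. -/

section Roots

variable {E : Type*} [NormedAddCommGroup E] [NormedSpace ℝ E]
  {G : Type*} [TopologicalSpace G] [ChartedSpace E G] [Group G] {σ : G →* G}

lemma eq_zero_of_mem_hAlg_of_mem_kAlg {X : GroupLieAlgebra 𝓘(ℝ, E) G} (hh : X ∈ hAlg E σ)
    (hk : X ∈ kAlg E σ) : X = 0 := by
  have h1 : dOne σ X = X := hh
  have h2 : dOne σ X = -X := hk
  rw [h1] at h2
  have h3 : (2 : ℝ) • X = 0 := by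
    rw [two_smul]
    nth_rewrite 1 [h2]
    exact neg_add_cancel X
  exact (smul_eq_zero.mp h3).resolve_left two_ne_zero

lemma IsInvolution.add_dOne_mem_hAlg (hσ : IsInvolution E σ) (X : GroupLieAlgebra 𝓘(ℝ, E) G) :
    X + dOne σ X ∈ hAlg E σ := by
  change dOne σ (X + dOne σ X) = X + dOne σ X
  rw [map_add, hσ.dOne_dOne, add_comm]

lemma IsInvolution.sub_dOne_mem_kAlg (hσ : IsInvolution E σ) (X : GroupLieAlgebra 𝓘(ℝ, E) G) :
    X - dOne σ X ∈ kAlg E σ := by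
  change dOne σ (X - dOne σ X) = -(X - dOne σ X)
  rw [map_sub, hσ.dOne_dOne, neg_sub]

variable {𝓐 𝓑 : Submodule ℝ (GroupLieAlgebra 𝓘(ℝ, E) G)} {ι : Type*}
  {e : ι → GroupLieAlgebra 𝓘(ℝ, E) G} {α : ι → Module.Dual ℝ 𝓐}

lemma IsRootDecomposition.exists_coord (he : IsRootDecomposition σ 𝓐 𝓑 e α) [DecidableEq ι] :
    ∃ κ : ι → GroupLieAlgebra 𝓘(ℝ, E) G →ₗ[ℝ] ℝ, (∀ i, ∀ Y ∈ 𝓐, κ i Y = 0) ∧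
      (∀ i j, κ i (e j) = if i = j then 1 else 0) ∧ ∀ i j, κ i (dOne σ (e j)) = 0 := by
  have hc : IsCompl (𝓐 ⊔ 𝓑)
      (Submodule.span ℝ (Set.range (Sum.elim e (fun i => dOne σ (e i))))) :=
    ⟨he.decomposition.disjoint_right, codisjoint_iff.mpr he.decomposition.sup_eq⟩
  obtain ⟨f, h1, h2⟩ := SymmetricReduction.exists_coord he.linearIndependent hc
  refine ⟨fun i => f (Sum.inl i), fun i Y hY => h1 _ Y (Submodule.mem_sup_left hY),
    fun i j => ?_, fun i j => ?_⟩
  · simpa using h2 (Sum.inl i) (Sum.inl j)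
  · simpa using h2 (Sum.inl i) (Sum.inr j)

variable [Fintype ι]

lemma IsRootDecomposition.exists_eq (he : IsRootDecomposition σ 𝓐 𝓑 e α)
    (X : GroupLieAlgebra 𝓘(ℝ, E) G) :
    ∃ a ∈ 𝓐, ∃ b ∈ 𝓑, ∃ x y : ι → ℝ, X = (a + ∑ i, x i • (e i - dOne σ (e i))) +
      (b + ∑ i, y i • (e i + dOne σ (e i))) := by
  have hX : X ∈ 𝓐 ⊔ 𝓑 ⊔ Submodule.span ℝ (Set.range (Sum.elim e (fun i => dOne σ (e i)))) := by
    rw [he.decomposition.sup_eq]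
    exact Submodule.mem_top
  obtain ⟨ab, hab, s, hs, rfl⟩ := Submodule.mem_sup.mp hX
  obtain ⟨a, ha, b, hb, rfl⟩ := Submodule.mem_sup.mp hab
  obtain ⟨c, rfl⟩ := (Submodule.mem_span_range_iff_exists_fun ℝ).mp hs
  -- Half-difference and half-sum of the coefficients of `e i` and `σ (e i)`.
  refine ⟨a, ha, b, hb, fun i => (c (Sum.inl i) - c (Sum.inr i)) / 2,
    fun i => (c (Sum.inl i) + c (Sum.inr i)) / 2, ?_⟩
  rw [Fintype.sum_sum_type, ← Finset.sum_add_distrib, add_add_add_comm, ← Finset.sum_add_distrib]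
  congr 1
  refine Finset.sum_congr rfl fun i _ => ?_
  simp only [Sum.elim_inl, Sum.elim_inr]
  module

lemma add_sum_mem_kAlg (hσ : IsInvolution E σ) (hAB : IsCartanPair σ 𝓐 𝓑)
    {a : GroupLieAlgebra 𝓘(ℝ, E) G} (ha : a ∈ 𝓐) (x : ι → ℝ) :
    a + ∑ i, x i • (e i - dOne σ (e i)) ∈ kAlg E σ :=
  add_mem (hAB.le_kAlg ha) (sum_mem fun _ _ => (kAlg E σ).smul_mem _ (hσ.sub_dOne_mem_kAlg _))

lemma sum_mem_hAlg (hσ : IsInvolution E σ) (y : ι → ℝ) :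
    ∑ i, y i • (e i + dOne σ (e i)) ∈ hAlg E σ :=
  sum_mem fun _ _ => (hAlg E σ).smul_mem _ (hσ.add_dOne_mem_hAlg _)

/-- The `𝓗`-part of the general decomposition is a difference of elements of `𝓚`, hence lies in `𝓗 ∩
𝓚 = 0`. -/
lemma exists_eq_of_mem_kAlg (hσ : IsInvolution E σ) (hAB : IsCartanPair σ 𝓐 𝓑)
    (he : IsRootDecomposition σ 𝓐 𝓑 e α) {X : GroupLieAlgebra 𝓘(ℝ, E) G} (hX : X ∈ kAlg E σ) :
    ∃ a ∈ 𝓐, ∃ x : ι → ℝ, X = a + ∑ i, x i • (e i - dOne σ (e i)) := by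
  obtain ⟨a, ha, b, hb, x, y, hxy⟩ := he.exists_eq X
  refine ⟨a, ha, x, ?_⟩
  have h1 := sub_mem hX (add_sum_mem_kAlg (e := e) hσ hAB ha x)
  have h2 := eq_zero_of_mem_hAlg_of_mem_kAlg (add_mem (hAB.le_hAlg hb) (sum_mem_hAlg hσ y)) (by
    rwa [hxy, add_sub_cancel_left] at h1)
  rw [hxy, h2, add_zero]

lemma exists_eq_of_mem_hAlg (hσ : IsInvolution E σ) (hAB : IsCartanPair σ 𝓐 𝓑)
    (he : IsRootDecomposition σ 𝓐 𝓑 e α) {X : GroupLieAlgebra 𝓘(ℝ, E) G} (hX : X ∈ hAlg E σ) :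
    ∃ b ∈ 𝓑, ∃ y : ι → ℝ, X = b + ∑ i, y i • (e i + dOne σ (e i)) := by
  obtain ⟨a, ha, b, hb, x, y, hxy⟩ := he.exists_eq X
  refine ⟨b, hb, y, ?_⟩
  have h1 := sub_mem hX (add_mem (hAB.le_hAlg hb) (sum_mem_hAlg hσ (e := e) y))
  have h2 := eq_zero_of_mem_hAlg_of_mem_kAlg (by rwa [hxy, add_sub_cancel_right] at h1)
    (add_sum_mem_kAlg hσ hAB ha x)
  rw [hxy, h2, zero_add]

lemma coord_add_sum {κ : ι → GroupLieAlgebra 𝓘(ℝ, E) G →ₗ[ℝ] ℝ} [DecidableEq ι]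
    (h1 : ∀ i, ∀ Y ∈ 𝓐, κ i Y = 0) (h2 : ∀ i j, κ i (e j) = if i = j then 1 else 0)
    (h3 : ∀ i j, κ i (dOne σ (e j)) = 0) {a : GroupLieAlgebra 𝓘(ℝ, E) G} (ha : a ∈ 𝓐)
    (x : ι → ℝ) (i : ι) : κ i (a + ∑ j, x j • (e j - dOne σ (e j))) = x i := by
  simp [h1 i a ha, h2, h3]

/-- The elements of `𝓚` in terms of the root vectors. -/
lemma mem_kAlg_iff_existsUnique (hσ : IsInvolution E σ) (hAB : IsCartanPair σ 𝓐 𝓑)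
    (he : IsRootDecomposition σ 𝓐 𝓑 e α) (X : GroupLieAlgebra 𝓘(ℝ, E) G) :
    X ∈ kAlg E σ ↔ ∃! x : 𝓐 × (ι → ℝ), X = (x.1 : GroupLieAlgebra 𝓘(ℝ, E) G) +
      ∑ i, x.2 i • (e i - dOne σ (e i)) := by
  classical
  constructor
  · intro hX
    obtain ⟨a, ha, x, rfl⟩ := exists_eq_of_mem_kAlg hσ hAB he hX
    refine ⟨(⟨a, ha⟩, x), rfl, ?_⟩
    rintro ⟨⟨a', ha'⟩, x'⟩ h
    obtain ⟨κ, h1, h2, h3⟩ := he.exists_coord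
    have hx : x' = x := by
      funext i
      rw [← coord_add_sum h1 h2 h3 ha x i, h, coord_add_sum h1 h2 h3 ha' x' i]
    subst hx
    have ha'' : a = a' := add_right_cancel h
    subst ha''
    rfl
  · rintro ⟨x, rfl, -⟩
    exact add_sum_mem_kAlg hσ hAB x.1.2 x.2

end Roots

/-! ### The level set `N_μ` and the derivative of `h₂` at the section. -/

section Section

variable {E : Type*} [NormedAddCommGroup E] [NormedSpace ℝ E]
  {G : Type*} [TopologicalSpace G] [ChartedSpace E G] [Group G]

lemma IsOneParameterSubgroup.continuousAt_zero {X : GroupLieAlgebra 𝓘(ℝ, E) G} {γ : ℝ → G}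
    (hγ : IsOneParameterSubgroup X γ) : Filter.Tendsto γ (𝓝 0) (𝓝 1) :=
  hγ.map_zero ▸ hγ.velocity.1

variable [LieGroup 𝓘(ℝ, E) ∞ G] {σ : G →* G}

lemma Ad_inv_apply_of_lie_eq_smul {X Y : GroupLieAlgebra 𝓘(ℝ, E) G} {g : G} (hg : IsExp X g)
    {c : ℝ} (hY : ⁅X, Y⁆ = c • Y) : Ad g⁻¹ Y = Real.exp (-c) • Y := by
  obtain ⟨γ, hγ, rfl⟩ := hg
  rw [← hγ.map_neg, hγ.Ad_apply_of_lie_eq_smul hY, mul_neg, mul_one]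

lemma Ad_inv_apply_of_lie_eq_zero {X Y : GroupLieAlgebra 𝓘(ℝ, E) G} {g : G} (hg : IsExp X g)
    (hY : ⁅X, Y⁆ = 0) : Ad g⁻¹ Y = Y := by
  rw [Ad_inv_apply_of_lie_eq_smul (c := 0) hg (by rw [hY, zero_smul]), neg_zero, Real.exp_zero,
    one_smul]

/-- In the left trivialisation a right translation twists the covector by `Ad h`. The left moment is
unchanged, and the right one stays zero since `Ad h` preserves `𝓗`. -/
lemma levelSet_mul_right (hσ : IsInvolution E σ) {μ ξ : Module.Dual ℝ (GroupLieAlgebra 𝓘(ℝ, E) G)}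
    {g h : G} (hg : (g, ξ) ∈ levelSet σ μ) (hh : h ∈ fixedSubgroup σ) :
    (g * h, ξ.comp (Ad h : GroupLieAlgebra 𝓘(ℝ, E) G →L[ℝ] GroupLieAlgebra 𝓘(ℝ, E) G).toLinearMap)
      ∈ levelSet σ μ := by
  refine ⟨fun X hX => ?_, fun X hX => hg.2 _ (hσ.Ad_mem_hAlg hh hX)⟩
  change ξ (Ad h (Ad (g * h)⁻¹ X)) = μ X
  rw [mul_inv_rev, Ad_mul_apply, Ad_Ad_inv_apply]
  exact hg.1 X hX

lemma levelSet_mul_left (hσ : IsInvolution E σ) {μ ξ : Module.Dual ℝ (GroupLieAlgebra 𝓘(ℝ, E) G)}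
    {g k : G} (hg : (g, ξ) ∈ levelSet σ μ) (hk : k ∈ isotropyGroup σ μ) :
    (k * g, ξ) ∈ levelSet σ μ := by
  refine ⟨fun X hX => ?_, hg.2⟩
  change ξ (Ad (k * g)⁻¹ X) = μ X
  rw [mul_inv_rev, Ad_mul_apply]
  exact (hg.1 _ (hσ.Ad_mem_hAlg (inv_mem hk.1) hX)).trans (hk.2 X hX)

/-- The derivative `∇_g f (X)` computed along a curve through `1` with velocity `X`. -/
lemma nabla_apply_eq_of_curve {f : G → G} {g : G} (hf : MDifferentiableAt 𝓘(ℝ, E) 𝓘(ℝ, E) f g)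
    {X Z : GroupLieAlgebra 𝓘(ℝ, E) G} {γ δ : ℝ → G} (hγ0 : γ 0 = 1)
    (hγ : HasMFDerivAt 𝓘(ℝ, ℝ) 𝓘(ℝ, E) γ 0 (ContinuousLinearMap.toSpanSingleton ℝ (X : E)))
    (hδ : HasMFDerivAt 𝓘(ℝ, ℝ) 𝓘(ℝ, E) δ 0 (ContinuousLinearMap.toSpanSingleton ℝ (Z : E)))
    (h : ∀ᶠ t in 𝓝 (0 : ℝ), f (g * γ t) = δ t) : nabla f g X = Z := by
  have h1 : MDifferentiableAt 𝓘(ℝ, E) 𝓘(ℝ, E) (fun x => f (g * x)) 1 := by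
    have hf' : MDifferentiableAt 𝓘(ℝ, E) 𝓘(ℝ, E) f (g * 1) := by rwa [mul_one]
    exact hf'.comp (1 : G) ((contMDiff_mul_left (I := 𝓘(ℝ, E)) (n := ∞)
      (a := g)).mdifferentiableAt (by simp))
  have h2 : HasMFDerivAt 𝓘(ℝ, E) 𝓘(ℝ, E) (fun x => f (g * x)) (γ 0)
      ((nabla f g : GroupLieAlgebra 𝓘(ℝ, E) G →L[ℝ] GroupLieAlgebra 𝓘(ℝ, E) G) : E →L[ℝ] E) := by
    rw [hγ0]
    exact h1.hasMFDerivAt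
  have h3 := h2.comp (0 : ℝ) hγ
  have h4 : ((fun x => f (g * x)) ∘ γ) =ᶠ[𝓝 0] δ := h
  have h5 := DFunLike.congr_fun (hasMFDerivAt_unique h3 (hδ.congr_of_eventuallyEq h4)) (1 : ℝ)
  have h6 : (nabla f g : E →L[ℝ] E) ((1 : ℝ) • (X : E)) = (1 : ℝ) • (Z : E) := h5
  rwa [one_smul, one_smul] at h6

variable {𝓐 𝓑 𝓒 : Submodule ℝ (GroupLieAlgebra 𝓘(ℝ, E) G)} {ι : Type*}
  {e : ι → GroupLieAlgebra 𝓘(ℝ, E) G} {α : ι → Module.Dual ℝ 𝓐}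
  {μ : Module.Dual ℝ (GroupLieAlgebra 𝓘(ℝ, E) G)} {Q : G} {h₂ : G → G}

/-- `h₂` along a curve `k · Q a · h` in `N_μ`. -/
lemma IsRightFactor.eventually_apply (hh₂ : IsRightFactor σ 𝓐 𝓒 μ Q h₂) {k a h : ℝ → G}
    (hk : Filter.Tendsto k (𝓝 0) (𝓝 1)) (ha : Filter.Tendsto a (𝓝 0) (𝓝 1))
    (hh : Filter.Tendsto h (𝓝 0) (𝓝 1))
    (hk' : ∀ t, k t ∈ isotropyGroup σ μ) (ha' : ∀ t, Q * a t ∈ expSet 𝓐)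
    (hh' : ∀ t, h t ∈ fixedSubgroup σ)
    (hξ : ∀ᶠ t in 𝓝 0, ∃ ξ, (k t * (Q * a t) * h t, ξ) ∈ levelSet σ μ) :
    ∀ᶠ t in 𝓝 0, h₂ (k t * (Q * a t) * h t) = h t := by
  have : IsTopologicalGroup G := topologicalGroup_of_lieGroup 𝓘(ℝ, E) ∞
  have hQa : Filter.Tendsto (fun t => Q * a t) (𝓝 0) (𝓝 Q) := by
    simpa only [mul_one] using ha.const_mul Q
  filter_upwards [(hk.prodMk_nhds (hQa.prodMk_nhds hh)).eventually hh₂.on_levelSet, hξ] with t ht h1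
  exact ht (hk' t) (ha' t) (hh' t) h1

lemma one_mem_isotropyGroup : (1 : G) ∈ isotropyGroup σ μ :=
  ⟨one_mem _, fun X _ => by rw [inv_one, Ad_one_apply]⟩

lemma IsCartanPair.Ad_inv_apply (hAB : IsCartanPair σ 𝓐 𝓑) {q : 𝓐}
    (hQ : IsExp (q : GroupLieAlgebra 𝓘(ℝ, E) G) Q) {b : GroupLieAlgebra 𝓘(ℝ, E) G} (hb : b ∈ 𝓑) :
    Ad Q⁻¹ b = b :=
  Ad_inv_apply_of_lie_eq_zero hQ
    (hAB.commute_sup q (Submodule.mem_sup_left q.2) b (Submodule.mem_sup_right hb))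

/-- If `(Q, L)` is in `N_μ`, then `μ` vanishes on `𝓑`. -/
lemma IsCartanPair.momentum_eq_zero (hAB : IsCartanPair σ 𝓐 𝓑) {q : 𝓐}
    (hQ : IsExp (q : GroupLieAlgebra 𝓘(ℝ, E) G) Q) {L : Module.Dual ℝ (GroupLieAlgebra 𝓘(ℝ, E) G)}
    (hL : (Q, L) ∈ levelSet σ μ) {b : GroupLieAlgebra 𝓘(ℝ, E) G} (hb : b ∈ 𝓑) : μ b = 0 := by
  rw [← hL.1 b (hAB.le_hAlg hb), hAB.Ad_inv_apply hQ hb]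
  exact neg_eq_zero.mp (hL.2 b (hAB.le_hAlg hb))

variable [T2Space G] [CompleteSpace E]

/-- `∇_g h₂` is the identity on `𝓗`. -/
lemma IsRightFactor.nabla_of_mem_hAlg (hσ : IsInvolution E σ) (hh₂ : IsRightFactor σ 𝓐 𝓒 μ Q h₂)
    {q : 𝓐} (hQ : IsExp (q : GroupLieAlgebra 𝓘(ℝ, E) G) Q)
    {L : Module.Dual ℝ (GroupLieAlgebra 𝓘(ℝ, E) G)} (hL : (Q, L) ∈ levelSet σ μ)
    {X : GroupLieAlgebra 𝓘(ℝ, E) G} (hX : X ∈ hAlg E σ) : nabla h₂ Q X = X := by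
  obtain ⟨γ, hγ⟩ := exists_isOneParameterSubgroup X
  have hfix := hσ.oneParameterSubgroup_mem_fixedSubgroup hX hγ
  refine nabla_apply_eq_of_curve hh₂.mdifferentiableAt hγ.map_zero hγ.velocity hγ.velocity ?_
  -- The curve is `Q exp(tX)`: only the right factor moves.
  have h := hh₂.eventually_apply (k := fun _ => 1) (a := fun _ => 1) tendsto_const_nhds
    tendsto_const_nhds hγ.continuousAt_zero (fun _ => one_mem_isotropyGroup)
    (fun _ => ⟨q, q.2, by rwa [mul_one]⟩) hfix (Filter.Eventually.of_forall fun t =>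
      ⟨_, by simpa only [one_mul, mul_one] using levelSet_mul_right hσ hL (hfix t)⟩)
  simpa only [one_mul, mul_one] using h

/-- `∇_g h₂ (Q⁻¹ X Q)` vanishes for `X` in `𝓗_μ`. -/
lemma IsRightFactor.nabla_Ad_inv_of_mem_isotropyAlgebra [FiniteDimensional ℝ E]
    (hσ : IsInvolution E σ) (hh₂ : IsRightFactor σ 𝓐 𝓒 μ Q h₂)
    {q : 𝓐} (hQ : IsExp (q : GroupLieAlgebra 𝓘(ℝ, E) G) Q)
    {L : Module.Dual ℝ (GroupLieAlgebra 𝓘(ℝ, E) G)} (hL : (Q, L) ∈ levelSet σ μ)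
    {X : GroupLieAlgebra 𝓘(ℝ, E) G} (hX : X ∈ isotropyAlgebra σ μ) :
    nabla h₂ Q (Ad Q⁻¹ X) = 0 := by
  obtain ⟨γ, hγ⟩ := exists_isOneParameterSubgroup X
  have hiso := hσ.oneParameterSubgroup_mem_isotropyGroup hX hγ
  have hγ' := hγ.conj Q⁻¹
  refine nabla_apply_eq_of_curve (δ := fun _ => 1) hh₂.mdifferentiableAt hγ'.map_zero
    hγ'.velocity ?_ ?_
  · refine (congrArg (HasMFDerivAt 𝓘(ℝ, ℝ) 𝓘(ℝ, E) (fun _ : ℝ => (1 : G)) 0) ?_).mp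
      (hasMFDerivAt_const (1 : G) (0 : ℝ))
    refine ContinuousLinearMap.ext_ring ?_
    exact (smul_zero (A := E) (1 : ℝ)).symm
  -- Only the `H_μ` factor moves, since `Q (Q⁻¹ γ(t) Q) = γ(t) Q`.
  have h := hh₂.eventually_apply (a := fun _ => 1) (h := fun _ => 1) hγ.continuousAt_zero
    tendsto_const_nhds tendsto_const_nhds hiso
    (fun _ => ⟨q, q.2, by rwa [mul_one]⟩) (fun _ => one_mem _) (Filter.Eventually.of_forall fun t =>
      ⟨_, by simpa only [mul_one] using levelSet_mul_left hσ hL (hiso t)⟩)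
  simpa [mul_assoc] using h

/-- Apply `σ` to the root equation and use `σ q = -q`. -/
lemma IsRootDecomposition.lie_dOne (hσ : IsInvolution E σ) (hAB : IsCartanPair σ 𝓐 𝓑)
    (he : IsRootDecomposition σ 𝓐 𝓑 e α) (i : ι) (q : 𝓐) :
    ⁅(q : GroupLieAlgebra 𝓘(ℝ, E) G), dOne σ (e i)⁆ = (-α i q) • dOne σ (e i) := by
  have h := congrArg (dOne σ) (he.root_vector i q)
  have hq : dOne σ (q : GroupLieAlgebra 𝓘(ℝ, E) G) = -q := hAB.le_kAlg q.2
  rw [hσ.dOne_lie, hq, neg_lie, map_smul] at h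
  rw [neg_smul, ← h, neg_neg]

lemma IsRootDecomposition.Ad_inv_add_dOne (hσ : IsInvolution E σ) (hAB : IsCartanPair σ 𝓐 𝓑)
    (he : IsRootDecomposition σ 𝓐 𝓑 e α) {q : 𝓐} (hQ : IsExp (q : GroupLieAlgebra 𝓘(ℝ, E) G) Q)
    (i : ι) : Ad Q⁻¹ (e i + dOne σ (e i)) = Real.cosh (α i q) • (e i + dOne σ (e i)) -
      Real.sinh (α i q) • (e i - dOne σ (e i)) := by
  rw [map_add, Ad_inv_apply_of_lie_eq_smul hQ (he.root_vector i q),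
    Ad_inv_apply_of_lie_eq_smul hQ (he.lie_dOne hσ hAB i q), neg_neg, Real.cosh_eq, Real.sinh_eq]
  module

variable [Fintype ι]

/-- Over a regular point of `A` there are points of `N_μ`, if `μ` vanishes on `𝓑`. -/
lemma exists_mem_levelSet (hσ : IsInvolution E σ) (hAB : IsCartanPair σ 𝓐 𝓑)
    (he : IsRootDecomposition σ 𝓐 𝓑 e α) (hμ : ∀ b ∈ 𝓑, μ b = 0) {q : 𝓐} (hq : ∀ i, α i q ≠ 0)
    (hQ : IsExp (q : GroupLieAlgebra 𝓘(ℝ, E) G) Q) : ∃ ξ, (Q, ξ) ∈ levelSet σ μ := by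
  classical
  obtain ⟨κ, -, h2, h3⟩ := he.exists_coord
  -- Antisymmetrising `f` gives a form vanishing on `𝓗`, and doubles its value on `e - σe`, whence
  -- the `2`. The left moment condition on `e + σe` then reads `-sinh α(q) ξ(e - σe) = μ(e + σe)`,
  -- solvable because `α(q) ≠ 0`; on `𝓑` it reads `μ = 0`.
  set f : GroupLieAlgebra 𝓘(ℝ, E) G →ₗ[ℝ] ℝ :=
    ∑ i, (-μ (e i + dOne σ (e i)) / (2 * Real.sinh (α i q))) • κ i with hf
  set ξ : GroupLieAlgebra 𝓘(ℝ, E) G →ₗ[ℝ] ℝ := f - f.comp (dOne σ).toLinearMap with hξ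
  have hξh : ∀ X ∈ hAlg E σ, ξ X = 0 := by
    intro X hX
    have hX' : dOne σ X = X := hX
    simp [hξ, hX']
  have hξk (i : ι) : Real.sinh (α i q) * ξ (e i - dOne σ (e i)) = -μ (e i + dOne σ (e i)) := by
    have hs : Real.sinh (α i q) ≠ 0 := Real.sinh_ne_zero.mpr (hq i)
    have h4 : ξ (e i - dOne σ (e i)) = 2 * (f (e i) - f (dOne σ (e i))) := by
      simp only [hξ, LinearMap.sub_apply, LinearMap.comp_apply, ContinuousLinearMap.coe_coe,
        map_sub, hσ.dOne_dOne]
      ring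
    have h5 : f (e i) = -μ (e i + dOne σ (e i)) / (2 * Real.sinh (α i q)) := by
      simp [hf, h2]
    have h6 : f (dOne σ (e i)) = 0 := by
      simp [hf, h3]
    rw [h4, h5, h6]
    field_simp
    ring
  refine ⟨ξ, fun X hX => ?_, fun X hX => ?_⟩
  · obtain ⟨b, hb, y, rfl⟩ := exists_eq_of_mem_hAlg hσ hAB he hX
    change ξ (Ad Q⁻¹ (b + ∑ i, y i • (e i + dOne σ (e i)))) = _
    rw [map_add, hAB.Ad_inv_apply hQ hb, map_add, hξh b (hAB.le_hAlg hb), map_add, hμ b hb,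
      map_sum, map_sum, map_sum]
    congr 1
    refine Finset.sum_congr rfl fun i _ => ?_
    rw [map_smul, he.Ad_inv_add_dOne hσ hAB hQ, map_smul, map_smul, map_sub, map_smul, map_smul,
      hξh _ (hσ.add_dOne_mem_hAlg _), smul_zero, zero_sub, smul_eq_mul (a := Real.sinh _), hξk,
      neg_neg]
  · change -ξ X = 0
    rw [hξh X hX, neg_zero]

/-- `∇_g h₂` vanishes on `𝓐`. -/
lemma IsRightFactor.nabla_of_mem_cartan (hσ : IsInvolution E σ) (hAB : IsCartanPair σ 𝓐 𝓑)
    (he : IsRootDecomposition σ 𝓐 𝓑 e α) (hh₂ : IsRightFactor σ 𝓐 𝓒 μ Q h₂)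
    {q : 𝓐} (hq : ∀ i, α i q ≠ 0) (hQ : IsExp (q : GroupLieAlgebra 𝓘(ℝ, E) G) Q)
    {L : Module.Dual ℝ (GroupLieAlgebra 𝓘(ℝ, E) G)} (hL : (Q, L) ∈ levelSet σ μ)
    {Y : GroupLieAlgebra 𝓘(ℝ, E) G} (hY : Y ∈ 𝓐) : nabla h₂ Q Y = 0 := by
  obtain ⟨γ, hγ⟩ := exists_isOneParameterSubgroup Y
  have hexp (t : ℝ) : IsExp ((q + t • ⟨Y, hY⟩ : 𝓐) : GroupLieAlgebra 𝓘(ℝ, E) G) (Q * γ t) :=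
    hQ.mul_oneParameterSubgroup hγ (hAB.commute q q.2 Y hY) t
  refine nabla_apply_eq_of_curve (δ := fun _ => 1) hh₂.mdifferentiableAt hγ.map_zero
    hγ.velocity ?_ ?_
  · refine (congrArg (HasMFDerivAt 𝓘(ℝ, ℝ) 𝓘(ℝ, E) (fun _ : ℝ => (1 : G)) 0) ?_).mp
      (hasMFDerivAt_const (1 : G) (0 : ℝ))
    refine ContinuousLinearMap.ext_ring ?_
    exact (smul_zero (A := E) (1 : ℝ)).symm
  -- Regularity is open because the family of roots is finite; it provides points of `N_μ` above `Q
  -- exp(tY)`.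
  have hreg : ∀ᶠ t in 𝓝 (0 : ℝ), ∀ i, α i (q + t • ⟨Y, hY⟩) ≠ 0 := by
    rw [Filter.eventually_all]
    intro i
    have hc : Continuous fun t : ℝ => α i q + t * α i ⟨Y, hY⟩ := by fun_prop
    have h0 : α i q + 0 * α i ⟨Y, hY⟩ ≠ 0 := by
      rw [zero_mul, add_zero]
      exact hq i
    filter_upwards [hc.continuousAt.eventually_ne h0] with t ht
    rwa [map_add, map_smul, smul_eq_mul]
  have h := hh₂.eventually_apply (k := fun _ => 1) (h := fun _ => 1) tendsto_const_nhds
    hγ.continuousAt_zero tendsto_const_nhds (fun _ => one_mem_isotropyGroup)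
    (fun t => ⟨_, (q + t • ⟨Y, hY⟩ : 𝓐).2, hexp t⟩) (fun _ => one_mem _)
    (by
      filter_upwards [hreg] with t ht
      obtain ⟨ξ, hξ⟩ := exists_mem_levelSet hσ hAB he
        (fun b hb => hAB.momentum_eq_zero hQ hL hb) ht (hexp t)
      exact ⟨ξ, by simpa only [one_mul, mul_one] using hξ⟩)
  simpa only [one_mul, mul_one] using h

end Section

end SymmetricReduction

/-! ### Assembly of the formula. -/

open SymmetricReduction in
theorem mainTheorem3
    {E : Type*} [NormedAddCommGroup E] [NormedSpace ℝ E] [FiniteDimensional ℝ E]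
    [CompleteSpace E]
    {G : Type*} [TopologicalSpace G] [T2Space G] [ChartedSpace E G] [Group G]
    [LieGroup 𝓘(ℝ, E) ∞ G]
    (σ : G →* G) (hσ : IsInvolution E σ)
    (𝓐 𝓑 𝓒 : Submodule ℝ (GroupLieAlgebra 𝓘(ℝ, E) G))
    (hAB : IsCartanPair σ 𝓐 𝓑)
    {ι : Type*} [Fintype ι]
    (e : ι → GroupLieAlgebra 𝓘(ℝ, E) G) (α : ι → Module.Dual ℝ 𝓐)
    (he : IsRootDecomposition σ 𝓐 𝓑 e α)
    (μ : Module.Dual ℝ (GroupLieAlgebra 𝓘(ℝ, E) G))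
    (hμ : IsMomentumSplitting σ μ 𝓑 𝓒)
    (q : 𝓐) (hq : ∀ i, α i q ≠ 0)
    (Q : G) (hQ : IsExp (q : GroupLieAlgebra 𝓘(ℝ, E) G) Q)
    (L : Module.Dual ℝ (GroupLieAlgebra 𝓘(ℝ, E) G)) (hL : (Q, L) ∈ levelSet σ μ)
    (h₂ : G → G) (hh₂ : IsRightFactor σ 𝓐 𝓒 μ Q h₂) :
    (∀ X : GroupLieAlgebra 𝓘(ℝ, E) G, X ∈ kAlg E σ ↔
      ∃! x : 𝓐 × (ι → ℝ), X = (x.1 : GroupLieAlgebra 𝓘(ℝ, E) G) +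
        ∑ i, x.2 i • (e i - dOne σ (e i))) ∧
    ∃ h₀ : GroupLieAlgebra 𝓘(ℝ, E) G →ₗ[ℝ] 𝓑,
      ∀ (X X₀ : GroupLieAlgebra 𝓘(ℝ, E) G) (x : ι → ℝ), X₀ ∈ 𝓐 →
        X = X₀ + ∑ i, x i • (e i - dOne σ (e i)) →
        (∀ b : 𝓑, (b : GroupLieAlgebra 𝓘(ℝ, E) G) -
            ∑ i, (x i / Real.sinh (α i q)) • (e i + dOne σ (e i)) ∈ isotropyAlgebra σ μ ⊔ 𝓒 ↔
          b = h₀ X) ∧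
        nabla h₂ Q X = -(h₀ X : GroupLieAlgebra 𝓘(ℝ, E) G) +
          ∑ i, (x i * (Real.cosh (α i q) / Real.sinh (α i q))) • (e i + dOne σ (e i)) := by
  classical
  refine ⟨mem_kAlg_iff_existsUnique hσ hAB he, ?_⟩
  obtain ⟨κ, h1, h2, h3⟩ := he.exists_coord
  obtain ⟨P, hP, hP0⟩ := hμ.directSum.exists_proj
  -- Reading the coefficient of `e i` recovers `x i`, so `W X` is linear in `X` on all of `𝓖` and
  -- equals `∑ (x i / sinh) (e i + σ (e i))` on `𝓚`.
  set W : GroupLieAlgebra 𝓘(ℝ, E) G →ₗ[ℝ] GroupLieAlgebra 𝓘(ℝ, E) G :=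
    ∑ i, (κ i).smulRight ((1 / Real.sinh (α i q)) • (e i + dOne σ (e i))) with hWdef
  refine ⟨P ∘ₗ W, ?_⟩
  rintro X X₀ x hX₀ rfl
  have hW : W (X₀ + ∑ i, x i • (e i - dOne σ (e i))) =
      ∑ i, (x i / Real.sinh (α i q)) • (e i + dOne σ (e i)) := by
    simp only [hWdef, LinearMap.sum_apply, LinearMap.smulRight_apply]
    refine Finset.sum_congr rfl fun i _ => ?_
    rw [coord_add_sum h1 h2 h3 hX₀ x i, smul_smul, mul_one_div]
  have hWh := sum_mem_hAlg (e := e) hσ (fun i => x i / Real.sinh (α i q))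
  simp only [LinearMap.comp_apply, hW]
  have hsplit := hμ.directSum.sub_mem_iff hP hP0 hWh
  refine ⟨hsplit, ?_⟩
  -- On `𝓗` the map `X ↦ ∇h₂(Q⁻¹XQ)` is the projection `P`: zero on `𝓗_μ` and `𝓒`, identity on `𝓑`.
  have hD : nabla h₂ Q (Ad Q⁻¹ (∑ i, (x i / Real.sinh (α i q)) • (e i + dOne σ (e i)))) =
      P (∑ i, (x i / Real.sinh (α i q)) • (e i + dOne σ (e i))) := by
    obtain ⟨y, hy, c, hc, hyc⟩ := Submodule.mem_sup.mp ((hsplit _).mpr rfl)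
    set b := P (∑ i, (x i / Real.sinh (α i q)) • (e i + dOne σ (e i)))
    have hb : ∑ i, (x i / Real.sinh (α i q)) • (e i + dOne σ (e i)) = b - (y + c) := by
      rw [hyc, sub_sub_cancel]
    rw [hb, map_sub, map_sub, map_add, map_add,
      hh₂.nabla_Ad_inv_of_mem_isotropyAlgebra hσ hQ hL hy, hh₂.normalisation c hc,
      hAB.Ad_inv_apply hQ b.2, hh₂.nabla_of_mem_hAlg hσ hQ hL (hAB.le_hAlg b.2), add_zero, sub_zero]
  -- The formula for `Ad Q⁻¹ (e + σe)`, solved for `e - σe`.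
  have hi (i : ι) : x i • (e i - dOne σ (e i)) =
      (x i * (Real.cosh (α i q) / Real.sinh (α i q))) • (e i + dOne σ (e i)) -
        Ad Q⁻¹ ((x i / Real.sinh (α i q)) • (e i + dOne σ (e i))) := by
    have hs : Real.sinh (α i q) ≠ 0 := Real.sinh_ne_zero.mpr (hq i)
    rw [map_smul, he.Ad_inv_add_dOne hσ hAB hQ, smul_sub (x i / _), smul_smul,
      smul_smul, div_mul_cancel₀ _ hs, div_mul_eq_mul_div, mul_div_assoc, sub_sub_cancel]
  rw [map_add, hh₂.nabla_of_mem_cartan hσ hAB he hq hQ hL hX₀, zero_add,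
    Finset.sum_congr rfl fun i _ => hi i, Finset.sum_sub_distrib, map_sub, ← map_sum (Ad Q⁻¹), hD,
    hh₂.nabla_of_mem_hAlg hσ hQ hL (sum_mem_hAlg hσ _), sub_eq_neg_add]
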